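/- Let $d \ge 1$. A \emph{$d$-polytope} is the convex hull of finitely many points of $\mathbb{R}^d$ that has nonempty interior; its face lattice consists of $\emptyset$, the polytope itself and its intersections with supporting hyperplanes, ordered by inclusion. A \emph{realization} of a $d$-polytope $P$ is a $d$-polytope $Q\subset\mathbb{R}^d$ whose face lattice is isomorphic to that of $P$. A \emph{stacked} $d$-polytope is a polytope obtained from a $d$-simplex by repeatedly stacking vertices onto facets: a polytope $P$ with a simplicial facet $F$ is replaced by $\operatorname{conv}(P\cup\{p\})$, where $p$ is a point lying strictly beyond (the hyperplane spanned by) $F$ and strictly beneath every other facet of $P$. A \emph{truncated} $d$-polytope is a $d$-polytope whose face lattice is anti-isomorphic to the face lattice of a stacked $d$-polytope. A $d$-polytope is \emph{circumscribable} if it has a realization all of whose facets are tangent to the unit sphere (the affine hull of each facet meets the sphere in exactly one point, and that point lies in the relative interior of the facet), and \emph{inscribable} if it has a realization all of whose vertices lie on the unit sphere. A \emph{smooth strictly convex body} is a compact strictly convex set $K\subset\mathbb{R}^d$ with nonempty interior that has a unique supporting hyperplane at each of its boundary points. Then: \begin{enumerate} \item Every stacked $d$-polytope is circumscribable. \item Every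 truncated $d$-polytope is inscribable. \item For every truncated $d$-polytope $P$ and every smooth strictly convex body $K\subset\mathbb{R}^d$, the polytope $P$ has a realization all of whose vertices lie on the boundary of $K$. \end{enumerate} -/

import Mathlib

namespace Scribability

/-- The Euclidean space of dimension `d`. -/
abbrev E (d : ℕ) : Type := EuclideanSpace ℝ (Fin d)

/-- A `d`-polytope in `d`-dimensional Euclidean space: the convex hull of finitely many points,
with nonempty interior. -/
structure IsPolytope {d : ℕ} (P : Set (E d)) : Prop where
  finite_hull : ∃ s : Finset (E d), P = convexHull ℝ (s : Set (E d))
  full_dim : (interior P).Nonempty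

/-- The face lattice of `P`, ordered by inclusion. The faces are the empty set, `P` itself and the
intersections of `P` with its supporting hyperplanes, that is, the exposed subsets of `P`. -/
abbrev FaceLattice {d : ℕ} (P : Set (E d)) : Type :=
  {F : Set (E d) // IsExposed ℝ P F}

/-- `F` is a (nonempty) face of `P` of dimension `k`. -/
structure IsFaceOfDim {d : ℕ} (P : Set (E d)) (k : ℕ) (F : Set (E d)) : Prop where
  exposed : IsExposed ℝ P F
  nonempty : F.Nonempty
  dim_eq : Module.finrank ℝ (vectorSpan ℝ F) = k

/-- `F` is a facet of the `d`-polytope `P`: a face of dimension `d - 1`. -/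
structure IsFacet {d : ℕ} (P F : Set (E d)) : Prop where
  exposed : IsExposed ℝ P F
  nonempty : F.Nonempty
  dim_eq : Module.finrank ℝ (vectorSpan ℝ F) + 1 = d

/-- `Q` is a realization of the combinatorial type of `P`: a `d`-polytope whose face lattice is
isomorphic to that of `P`. -/
def IsRealization {d : ℕ} (Q P : Set (E d)) : Prop :=
  IsPolytope Q ∧ Nonempty (FaceLattice Q ≃o FaceLattice P)

/-- `P` and `Q` are combinatorially dual: their face lattices are anti-isomorphic. -/
def AreDual {d : ℕ} (P Q : Set (E d)) : Prop :=
  Nonempty (FaceLattice P ≃o (FaceLattice Q)ᵒᵈ)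

/-- `S` is a simplex of dimension `k`. -/
def IsSimplex {d : ℕ} (k : ℕ) (S : Set (E d)) : Prop :=
  ∃ s : Affine.Simplex ℝ (E d) k, S = convexHull ℝ (Set.range s.points)

/-- `p` is beyond the facet `F` of `P`: the hyperplane spanned by `F` strictly separates `p` from
the interior of `P`. -/
def IsBeyond {d : ℕ} (P F : Set (E d)) (p : E d) : Prop :=
  ∃ (l : E d →L[ℝ] ℝ) (c : ℝ), (∀ y ∈ P, l y ≤ c) ∧ F = {y ∈ P | l y = c} ∧ c < l p

/-- `p` is beneath the facet `F` of `P`: `p` lies strictly on the same side as the interior of `P`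
of the hyperplane spanned by `F`. -/
def IsBeneath {d : ℕ} (P F : Set (E d)) (p : E d) : Prop :=
  ∃ (l : E d →L[ℝ] ℝ) (c : ℝ), (∀ y ∈ P, l y ≤ c) ∧ F = {y ∈ P | l y = c} ∧ l p < c

/-- `p` can be stacked onto the simplicial facet `F` of `P`: it is beyond `F` and beneath every
other facet of `P`. This holds for all points outside `P` close enough to the barycenter of `F`. -/
structure IsStackingPoint {d : ℕ} (P F : Set (E d)) (p : E d) : Prop where
  facet : IsFacet P F
  simplicial : IsSimplex (d - 1) F
  beyond : IsBeyond P F p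
  beneath : ∀ G : Set (E d), IsFacet P G → G ≠ F → IsBeneath P G p

/-- Stacked `d`-polytopes: obtained from a `d`-simplex by repeatedly stacking a vertex onto a
facet. -/
inductive IsStacked {d : ℕ} : Set (E d) → Prop
  | simplex (P : Set (E d)) : IsSimplex d P → IsStacked P
  | stack (P F : Set (E d)) (p : E d) :
      IsStacked P → IsStackingPoint P F p → IsStacked (convexHull ℝ (insert p P))

/-- Truncated `d`-polytopes: the `d`-polytopes that are dual to a stacked `d`-polytope. -/
def IsTruncated {d : ℕ} (P : Set (E d)) : Prop :=
  IsPolytope P ∧ ∃ S : Set (E d), IsStacked S ∧ AreDual P S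

/-- The face `F` is tangent to the unit sphere: its affine hull meets the sphere in exactly one
point, and this point is in the relative interior of `F`. -/
def IsTangent {d : ℕ} (F : Set (E d)) : Prop :=
  ∃ t ∈ intrinsicInterior ℝ F,
    (affineSpan ℝ F : Set (E d)) ∩ Metric.sphere (0 : E d) 1 = {t}

/-- All `k`-faces of `P` are tangent to the unit sphere. -/
def IsScribed {d : ℕ} (k : ℕ) (P : Set (E d)) : Prop :=
  ∀ F : Set (E d), IsFaceOfDim P k F → IsTangent F

/-- `P` has a realization that is `k`-scribed. -/
def IsScribable {d : ℕ} (k : ℕ) (P : Set (E d)) : Prop :=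
  ∃ Q : Set (E d), IsRealization Q P ∧ IsScribed k Q

/-- `P` is inscribable: it has a realization with all vertices on the unit sphere. -/
def IsInscribable {d : ℕ} (P : Set (E d)) : Prop := IsScribable 0 P

/-- `P` is circumscribable: it has a realization with all facets tangent to the unit sphere. -/
def IsCircumscribable {d : ℕ} (P : Set (E d)) : Prop := IsScribable (d - 1) P

/-- Smooth strictly convex bodies: compact strictly convex sets with nonempty interior, which have
only one supporting hyperplane at each boundary point (any two outer normal functionals at the
point are positive multiples of each other). -/
structure IsSmoothStrictlyConvexBody {d : ℕ} (K : Set (E d)) : Prop where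
  compact : IsCompact K
  strictConvex : StrictConvex ℝ K
  interior_nonempty : (interior K).Nonempty
  smooth : ∀ x ∈ frontier K, ∀ l m : E d →L[ℝ] ℝ, l ≠ 0 → m ≠ 0 →
    (∀ y ∈ K, l y ≤ l x) → (∀ y ∈ K, m y ≤ m x) → ∃ c : ℝ, 0 < c ∧ m = c • l

/-- `P` is inscribable in `K`: it has a realization with all vertices on the boundary of `K`. -/
def IsInscribableIn {d : ℕ} (P K : Set (E d)) : Prop :=
  ∃ Q : Set (E d), IsRealization Q P ∧ ∀ v ∈ Set.extremePoints ℝ Q, v ∈ frontier K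

end Scribability

/-! The face lattice of a polytope is the concept lattice of its incidence relation between vertices
and facet inequalities (`nonempty_faceLattice_equiv_concept`). So only the boundary complex of a
stacked polytope matters. One well-placed realization of each `StackedComplex` suffices, and its
polar settles the truncated case, because transposing the incidence reverses the lattice.

Write the facet inequalities as `0 ≤ 1 - ⟪v F, y⟫`, so that the normals `v F` are the vertices of
the polar polytope. Stacking onto `F` then means cutting off the vertex `v F` by a hyperplane. The
goal is to have all `v F` on the boundary of a strictly convex body `K` around the origin, but a
vertex about to be cut off should still lie outside `K`. Hence the induction in
`StackedComplex.exists_scribes` proves more: any prescribed normals can be placed outside `K`, and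
all others on its boundary.

For the induction step, let `v F` be outside `K`. Every edge of the polar at `v F` meets the
interior of `K`; cut it where it first enters `K`, or slightly earlier if the new vertex has to stay
outside (`Scribes.exists_cut`). By strict convexity the new edges between cut points again meet the
interior, and the old edges lose only points outside `K`. The cutting hyperplane must moreover leave
the origin strictly on the side of the remaining vertices, since only then is it polar to a point
that can be stacked. This is what `core` guarantees (`Scribes.exists_apex`), and `core` survives the
cut for the same reason as the old edges do.

For the unit ball the `v F` are unit vectors: facet `F` touches the sphere at `v F`, and the polar
is inscribed. For general `K`, an interior point is moved to the origin and the polar is taken. -/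

namespace Scribability

open Module

/-! ### Convex combinations and exposed faces -/

section Combinations

variable {d : ℕ} {α β : Type*} [Fintype α]

theorem affineMap_sum (k : E d →ᵃ[ℝ] ℝ) (w : α → ℝ) (hw : ∑ a, w a = 1) (p : α → E d) :
    k (∑ a, w a • p a) = ∑ a, w a * k (p a) := by
  have h : ∀ y, k y = k.linear y + k 0 := fun y => congrFun k.decomp y
  rw [h, map_sum]
  simp_rw [h (p _), mul_add, Finset.sum_add_distrib, ← Finset.sum_mul, hw, map_smul, smul_eq_mul,
    one_mul]

theorem mem_convexHull_range_iff (p : α → E d) (y : E d) :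
    y ∈ convexHull ℝ (Set.range p) ↔
      ∃ w : α → ℝ, (∀ a, 0 ≤ w a) ∧ ∑ a, w a = 1 ∧ ∑ a, w a • p a = y := by
  classical
  constructor
  · intro hy
    refine convexHull_min (t := {y | ∃ w : α → ℝ, (∀ a, 0 ≤ w a) ∧ ∑ a, w a = 1 ∧
      ∑ a, w a • p a = y}) ?_ ?_ hy
    · rintro _ ⟨a, rfl⟩
      refine ⟨fun b => if b = a then 1 else 0, fun b => by positivity, by simp, by simp⟩
    · rintro _ ⟨w, hw, hw1, rfl⟩ _ ⟨u, hu, hu1, rfl⟩ s t hs ht hst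
      refine ⟨fun a => s * w a + t * u a, fun a => ?_, ?_, ?_⟩
      · have := hw a
        have := hu a
        positivity
      · rw [Finset.sum_add_distrib, ← Finset.mul_sum, ← Finset.mul_sum, hw1, hu1]
        linarith
      · simp_rw [add_smul, Finset.sum_add_distrib, mul_smul, Finset.smul_sum]
  · rintro ⟨w, hw, hw1, rfl⟩
    exact (convex_convexHull ℝ _).sum_mem (fun a _ => hw a) hw1
      (fun a _ => subset_convexHull ℝ _ ⟨a, rfl⟩)

/-- If a face of a polytope is the set of maximizers of `l`, then it is spanned by the generators
that it contains. -/
theorem mem_convexHull_of_isExposed (p : α → E d) {G : Set (E d)}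
    (hG : IsExposed ℝ (convexHull ℝ (Set.range p)) G) {y : E d} (hy : y ∈ G) :
    ∃ w : α → ℝ, (∀ a, 0 ≤ w a) ∧ ∑ a, w a = 1 ∧ ∑ a, w a • p a = y ∧
      ∀ a, w a ≠ 0 → p a ∈ G := by
  obtain ⟨l, hl⟩ := hG ⟨y, hy⟩
  rw [hl] at hy
  obtain ⟨w, hw, hw1, hwy⟩ := (mem_convexHull_range_iff p y).1 hy.1
  refine ⟨w, hw, hw1, hwy, fun a ha => ?_⟩
  have hmem : ∀ a, p a ∈ convexHull ℝ (Set.range p) := fun a => subset_convexHull ℝ _ ⟨a, rfl⟩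
  have hle : ∀ a, l (p a) ≤ l y := fun a => hy.2 _ (hmem a)
  have hsum : ∑ a, w a * (l y - l (p a)) = 0 := by
    simp_rw [mul_sub, Finset.sum_sub_distrib, ← Finset.sum_mul, hw1]
    have : l y = ∑ a, w a * l (p a) := by rw [← hwy, map_sum]; simp
    linarith
  have h0 := (Finset.sum_eq_zero_iff_of_nonneg
    (fun a _ => mul_nonneg (hw a) (sub_nonneg.2 (hle a)))).1 hsum a (Finset.mem_univ _)
  have h1 : l (p a) = l y := by
    rcases mul_eq_zero.1 h0 with h | h
    · exact absurd h ha
    · linarith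
  rw [hl]
  exact ⟨hmem a, fun z hz => h1 ▸ hy.2 z hz⟩

/-- If the zero set is nonempty, then zero is the minimum of `k` on `P`, and the negative of the
linear part exposes it. The definition of an exposed set asks for nothing in the empty case. -/
theorem isExposed_of_affineMap {P : Set (E d)} (k : E d →ᵃ[ℝ] ℝ) (hk : ∀ y ∈ P, 0 ≤ k y) :
    IsExposed ℝ P {y ∈ P | k y = 0} := by
  rintro ⟨z, hzP, hz⟩
  have h : ∀ y, k y = k.linear y + k 0 := fun y => congrFun k.decomp y
  refine ⟨-(LinearMap.toContinuousLinearMap k.linear), ?_⟩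
  ext y
  simp only [Set.mem_ofPred_eq, neg_apply, LinearMap.coe_toContinuousLinearMap', neg_le_neg_iff]
  refine and_congr_right fun hy => ⟨fun h0 x hx => ?_, fun hm => ?_⟩
  · have := hk x hx
    rw [h] at this h0
    linarith
  · have := hm z hzP
    have h1 := hk y hy
    rw [h] at hz h1 ⊢
    linarith

end Combinations

/-! ### Points and affine functionals dual up to scaling -/

section DualBasis

variable {d : ℕ} {α : Type*} [Fintype α] (q : α → E d) (g : α → E d →ᵃ[ℝ] ℝ)

theorem affineIndependent_of_dual (h0 : ∀ k l, k ≠ l → g k (q l) = 0)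
    (h1 : ∀ k, g k (q k) ≠ 0) : AffineIndependent ℝ q := by
  classical
  rw [affineIndependent_iff_of_fintype]
  intro w hw hwq a
  rw [Finset.weightedVSub_eq_weightedVSubOfPoint_of_sum_eq_zero _ w q hw 0] at hwq
  simp only [Finset.weightedVSubOfPoint_apply, vsub_eq_sub, sub_zero] at hwq
  have h : ∀ y, g a y = (g a).linear y + g a 0 := fun y => congrFun (g a).decomp y
  have : ∑ b, w b * g a (q b) = 0 := by
    simp_rw [h (q _), mul_add, Finset.sum_add_distrib, ← Finset.sum_mul, hw]
    have := congrArg (g a).linear hwq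
    simpa using this
  rw [Finset.sum_eq_single a (fun b _ hb => by rw [h0 a b hb.symm, mul_zero]) (by simp)] at this
  exact (mul_eq_zero.1 this).resolve_right (h1 a)

variable (hcard : Fintype.card α = d + 1) (h0 : ∀ k l, k ≠ l → g k (q l) = 0)
  (h1 : ∀ k, g k (q k) ≠ 0)

include hcard h0 h1

/-- There are `d + 1` affinely independent points, hence an affine basis, and the normalized
functionals are its barycentric coordinates. This serves to locate points in simplices and to expand
affine functions. -/
theorem dual_sum (y : E d) :
    ∑ a, g a y / g a (q a) = 1 ∧ ∑ a, (g a y / g a (q a)) • q a = y := by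
  classical
  have hind := affineIndependent_of_dual q g h0 h1
  have htop : affineSpan ℝ (Set.range q) = ⊤ := by
    rw [hind.affineSpan_eq_top_iff_card_eq_finrank_add_one, hcard, finrank_euclideanSpace_fin]
  let b : AffineBasis α ℝ (E d) := ⟨q, hind, htop⟩
  have hb : ∀ a, b a = q a := fun a => rfl
  have hc : ∀ a, g a y / g a (q a) = b.coord a y := by
    intro a
    have hy := b.linear_combination_coord_eq_self y
    have := affineMap_sum (g a) (fun c => b.coord c y) (b.sum_coord_apply_eq_one y) q
    simp_rw [← hb] at this
    rw [hy, Finset.sum_eq_single a (fun c _ hc => by rw [hb, h0 a c hc.symm, mul_zero])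
      (by simp)] at this
    rw [div_eq_iff (h1 a), this, hb]
  simp_rw [hc]
  exact ⟨b.sum_coord_apply_eq_one y, b.linear_combination_coord_eq_self y⟩

theorem dual_expansion (k : E d →ᵃ[ℝ] ℝ) (y : E d) :
    k y = ∑ a, g a y / g a (q a) * k (q a) := by
  obtain ⟨hs, hy⟩ := dual_sum q g hcard h0 h1 y
  rw [← affineMap_sum k _ hs q, hy]

end DualBasis

/-! ### Face lattices as concept lattices -/

section FaceLattice

variable {d : ℕ} {α β : Type*} [Finite α] [Finite β]

/-- Moving a bit from `g` away from `z` does not violate constraints that are inactive at `g`, nor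
constraints that are active both at `g` and at `z`. -/
theorem exists_extension (k : β → E d →ᵃ[ℝ] ℝ) (g z : E d) (hg : ∀ b, 0 ≤ k b g)
    (hz : ∀ b, k b g = 0 → k b z ≤ 0) :
    ∃ ε : ℝ, 0 < ε ∧ ∀ b, 0 ≤ k b (AffineMap.lineMap g z (-ε)) := by
  have key : ∀ᶠ ε : ℝ in nhdsWithin 0 (Set.Ioi 0),
      ∀ b, 0 ≤ k b (AffineMap.lineMap g z (-ε)) := by
    rw [Filter.eventually_all]
    intro b
    have hform : ∀ ε : ℝ, k b (AffineMap.lineMap g z (-ε)) = k b g - ε * (k b z - k b g) := by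
      intro ε
      rw [AffineMap.apply_lineMap, AffineMap.lineMap_apply_module']
      simp only [smul_eq_mul]
      ring
    simp_rw [hform]
    rcases eq_or_lt_of_le (hg b) with h | h
    · filter_upwards [self_mem_nhdsWithin] with ε hε
      have := hz b h.symm
      have hε : (0 : ℝ) < ε := hε
      rw [← h]
      nlinarith
    · have hc : Filter.Tendsto (fun ε : ℝ => k b g - ε * (k b z - k b g))
          (nhdsWithin 0 (Set.Ioi 0)) (nhds (k b g - 0 * (k b z - k b g))) :=
        (Continuous.tendsto (by fun_prop) 0).mono_left nhdsWithin_le_nhds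
      rw [zero_mul, sub_zero] at hc
      filter_upwards [hc.eventually (lt_mem_nhds h)] with ε hε using hε.le
  obtain ⟨ε, h1, h2⟩ := (key.and self_mem_nhdsWithin).exists
  exact ⟨ε, h2, h1⟩

variable (p : α → E d) (k : β → E d →ᵃ[ℝ] ℝ)

/-- The generators that lie in a face form an extent of the incidence relation. -/
theorem mem_face_of_incident (hP : ∀ y, y ∈ convexHull ℝ (Set.range p) ↔ ∀ b, 0 ≤ k b y)
    (hne : ∀ a, ∃ b, k b (p a) ≠ 0) {G : Set (E d)}
    (hG : IsExposed ℝ (convexHull ℝ (Set.range p)) G) {a : α}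
    (ha : ∀ b, (∀ c, p c ∈ G → k b (p c) = 0) → k b (p a) = 0) : p a ∈ G := by
  classical
  have := Fintype.ofFinite α
  have hmem : ∀ a, p a ∈ convexHull ℝ (Set.range p) := fun a => subset_convexHull ℝ _ ⟨a, rfl⟩
  by_cases hGe : ∃ c, p c ∈ G
  swap
  · push Not at hGe
    obtain ⟨b, hb⟩ := hne a
    exact absurd (ha b fun c hc => absurd hc (hGe c)) hb
  obtain ⟨c, hc⟩ := hGe
  obtain ⟨l, hl⟩ := hG ⟨_, hc⟩
  set T : Finset α := Finset.univ.filter fun c => p c ∈ G with hT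
  have hTne : T.Nonempty := ⟨c, by simp [hT, hc]⟩
  have hcard : (0 : ℝ) < T.card := by exact_mod_cast hTne.card_pos
  set w : α → ℝ := fun a => if a ∈ T then (T.card : ℝ)⁻¹ else 0 with hw
  have hw0 : ∀ a, 0 ≤ w a := fun a => by simp only [hw]; positivity
  have hw1 : ∑ a, w a = 1 := by
    simp [hw, hcard.ne']
  set g := ∑ a, w a • p a with hg
  have hgP : g ∈ convexHull ℝ (Set.range p) := (mem_convexHull_range_iff p g).2 ⟨w, hw0, hw1, rfl⟩
  have hlc : ∀ a ∈ T, l (p a) = l (p c) := by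
    intro a haT
    have haG : p a ∈ G := by simpa [hT] using haT
    rw [hl] at haG hc
    exact le_antisymm (hc.2 _ haG.1) (haG.2 _ hc.1)
  have hlg : l g = l (p c) := by
    have : l g = ∑ a, w a * l (p c) := by
      rw [hg, map_sum]
      refine Finset.sum_congr rfl fun a _ => ?_
      rw [map_smul, smul_eq_mul]
      by_cases haT : a ∈ T
      · rw [hlc a haT]
      · simp [hw, haT]
    rw [this, ← Finset.sum_mul, hw1, one_mul]
  -- Here `g` is the barycenter of the generators in `G`, so an inequality tight at `g` is tight at
  -- all of them, and by `ha` at `p a`. The segment from `p a` to `g` therefore extends beyond `g`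
  -- inside the polytope. Since `l` is maximal at `g`, it cannot be smaller at `p a`.
  obtain ⟨ε, hε, hext⟩ := exists_extension k g (p a) ((hP g).1 hgP) (by
    intro b hb
    refine (ha b fun c hc => ?_).le
    rw [hg, affineMap_sum _ _ hw1] at hb
    have := (Finset.sum_eq_zero_iff_of_nonneg
      (fun a _ => mul_nonneg (hw0 a) ((hP _).1 (hmem a) b))).1 hb c (Finset.mem_univ _)
    have hcT : c ∈ T := by simp [hT, hc]
    simp only [hw, hcT, if_true] at this
    rcases mul_eq_zero.1 this with h | h
    · exact absurd h (by positivity)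
    · exact h)
  have h1 := (hP _).2 hext
  rw [hl] at hc ⊢
  refine ⟨hmem a, fun y hy => (hc.2 y hy).trans ?_⟩
  have h2 := hc.2 _ h1
  rw [AffineMap.lineMap_apply_module', map_add, map_smul, map_sub, smul_eq_mul, hlg] at h2
  nlinarith

/-- The faces of a polytope given by generators and by inequalities correspond to the formal
concepts of the incidence relation of generators and inequalities. -/
theorem nonempty_faceLattice_equiv_concept
    (hP : ∀ y, y ∈ convexHull ℝ (Set.range p) ↔ ∀ b, 0 ≤ k b y)
    (hne : ∀ a, ∃ b, k b (p a) ≠ 0) :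
    Nonempty (FaceLattice (convexHull ℝ (Set.range p)) ≃o
      Concept α β (fun a b => k b (p a) = 0)) := by
  classical
  have := Fintype.ofFinite α
  have := Fintype.ofFinite β
  have hmem : ∀ a, p a ∈ convexHull ℝ (Set.range p) := fun a => subset_convexHull ℝ _ ⟨a, rfl⟩
  have hext : ∀ G : FaceLattice (convexHull ℝ (Set.range p)),
      Order.IsExtent (fun a b => k b (p a) = 0) {a | p a ∈ G.1} := by
    intro G
    rw [Order.isExtent_iff]
    refine subset_antisymm (fun a ha => ?_) (subset_lowerPolar_upperPolar _ _)
    exact mem_face_of_incident p k hP hne G.2 fun b hb => ha fun c hc => hb c hc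
  let f : FaceLattice (convexHull ℝ (Set.range p)) ↪o Concept α β (fun a b => k b (p a) = 0) :=
    OrderEmbedding.ofMapLEIff (fun G => Concept.ofIsExtent _ _ (hext G)) (by
      intro G G'
      rw [← Concept.extent_subset_extent_iff]
      constructor
      · intro h y hy
        obtain ⟨w, hw, hw1, rfl, hwG⟩ := mem_convexHull_of_isExposed p G.2 hy
        have hw0 : ∑ a, w a ≠ 0 := by rw [hw1]; exact one_ne_zero
        have hconv : Convex ℝ G'.1 := G'.2.convex (convex_convexHull ℝ _)
        have hsub : ∀ a, w a ≠ 0 → p a ∈ G'.1 := fun a ha => h (hwG a ha)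
        rw [← Finset.sum_filter_of_ne (p := fun a => w a ≠ 0)
          (fun a _ ha h0 => ha (by rw [h0, zero_smul]))]
        refine hconv.sum_mem (fun a _ => hw a) ?_ fun a ha => hsub a (Finset.mem_filter.1 ha).2
        rw [Finset.sum_filter_ne_zero, hw1]
      · exact fun h a ha => h ha)
  refine ⟨RelIso.ofSurjective f fun c => ?_⟩
  -- Surjectivity: on the polytope, the sum of the inequalities in the intent vanishes exactly where
  -- all of them are tight, so it exposes the face with the given extent.
  let m : E d →ᵃ[ℝ] ℝ := ∑ b, if b ∈ c.intent then k b else 0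
  have hm : ∀ y, m y = ∑ b, if b ∈ c.intent then k b y else 0 := by
    intro y
    have : m y = ∑ b, (if b ∈ c.intent then k b else 0) y := by
      simp only [m]
      exact map_sum (⟨⟨fun u : E d →ᵃ[ℝ] ℝ => u y, rfl⟩, fun _ _ => rfl⟩ :
        (E d →ᵃ[ℝ] ℝ) →+ ℝ) _ _
    rw [this]
    refine Finset.sum_congr rfl fun b _ => ?_
    split_ifs <;> rfl
  have hterm : ∀ y ∈ convexHull ℝ (Set.range p), ∀ b,
      0 ≤ if b ∈ c.intent then k b y else 0 := by
    intro y hy b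
    split_ifs
    · exact (hP y).1 hy b
    · exact le_rfl
  refine ⟨⟨_, isExposed_of_affineMap m fun y hy => ?_⟩, ?_⟩
  · rw [hm]
    exact Finset.sum_nonneg fun b _ => hterm y hy b
  · refine Concept.ext ?_
    rw [← c.lowerPolar_intent]
    ext a
    change (p a ∈ convexHull ℝ (Set.range p) ∧ m (p a) = 0) ↔ _
    rw [hm, Finset.sum_eq_zero_iff_of_nonneg fun b _ => hterm _ (hmem a) b,
      mem_lowerPolar_iff]
    constructor
    · rintro ⟨-, h⟩ b hb
      simpa [hb] using h b (Finset.mem_univ _)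
    · refine fun h => ⟨hmem a, fun b _ => ?_⟩
      split_ifs with hb
      · exact h hb
      · rfl

end FaceLattice

/-! ### Combinatorics of stacked complexes -/

section Complexes

/-- The facets that arise when the facet `F` of a simplicial complex with facets `𝓕` is replaced by
the cone with apex `n` over its boundary. -/
def stackFacets (𝓕 : Finset (Finset ℕ)) (F : Finset ℕ) (n : ℕ) : Finset (Finset ℕ) :=
  𝓕.erase F ∪ F.image fun i => insert n (F.erase i)

/-- The boundary complexes of stacked `d`-polytopes, given by vertex sets and sets of facets. -/
inductive StackedComplex (d : ℕ) : Finset ℕ → Finset (Finset ℕ) → Prop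
  | simplex : StackedComplex d (Finset.range (d + 1))
      ((Finset.range (d + 1)).image fun i => (Finset.range (d + 1)).erase i)
  | stack (V : Finset ℕ) (𝓕 : Finset (Finset ℕ)) (F : Finset ℕ) (n : ℕ) :
      StackedComplex d V 𝓕 → F ∈ 𝓕 → n ∉ V →
        StackedComplex d (insert n V) (stackFacets 𝓕 F n)

/-- A pure simplicial complex with facets of size `d` in which every ridge lies in exactly two
facets. -/
structure IsPseudomanifold (d : ℕ) (V : Finset ℕ) (𝓕 : Finset (Finset ℕ)) : Prop where
  nonempty : 𝓕.Nonempty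
  subset : ∀ F ∈ 𝓕, F ⊆ V
  card : ∀ F ∈ 𝓕, F.card = d
  neighbor : ∀ F ∈ 𝓕, ∀ i ∈ F, ∃ N ∈ 𝓕, N ≠ F ∧ F.erase i ⊆ N ∧
    ∀ N' ∈ 𝓕, N' ≠ F → F.erase i ⊆ N' → N' = N

theorem mem_stackFacets {𝓕 : Finset (Finset ℕ)} {F G : Finset ℕ} {n : ℕ} :
    G ∈ stackFacets 𝓕 F n ↔ (G ∈ 𝓕 ∧ G ≠ F) ∨ ∃ i ∈ F, insert n (F.erase i) = G := by
  simp [stackFacets, and_comm]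

theorem eq_of_erase_subset_insert {F : Finset ℕ} {n i j : ℕ} (hn : n ∉ F) (hj : j ∈ F)
    (h : F.erase i ⊆ insert n (F.erase j)) : j = i := by
  by_contra hji
  have := h (Finset.mem_erase.2 ⟨hji, hj⟩)
  rcases Finset.mem_insert.1 this with rfl | h
  · exact hn hj
  · exact (Finset.mem_erase.1 h).1 rfl

namespace IsPseudomanifold

variable {d : ℕ} {V : Finset ℕ} {𝓕 : Finset (Finset ℕ)} {F : Finset ℕ} {n : ℕ}

theorem eq_of_subset (h : IsPseudomanifold d V 𝓕) {F G : Finset ℕ} (hF : F ∈ 𝓕) (hG : G ∈ 𝓕)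
    (hFG : F ⊆ G) : F = G :=
  Finset.eq_of_subset_of_card_le hFG (by rw [h.card F hF, h.card G hG])

theorem notMem_of_erase_subset (h : IsPseudomanifold d V 𝓕) {F N : Finset ℕ} (hF : F ∈ 𝓕)
    (hN : N ∈ 𝓕) (hne : N ≠ F) {i : ℕ} (hi : F.erase i ⊆ N) : i ∉ N := by
  intro hiN
  refine hne (h.eq_of_subset hF hN fun j hj => ?_).symm
  by_cases hji : j = i
  · exact hji ▸ hiN
  · exact hi (Finset.mem_erase.2 ⟨hji, hj⟩)

theorem notMem (h : IsPseudomanifold d V 𝓕) (hF : F ∈ 𝓕) (hn : n ∉ V) : n ∉ F :=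
  fun hnF => hn (h.subset F hF hnF)

theorem simplex : IsPseudomanifold d (Finset.range (d + 1))
    ((Finset.range (d + 1)).image fun i => (Finset.range (d + 1)).erase i) := by
  refine ⟨by simp, ?_, ?_, ?_⟩
  · simp only [Finset.mem_image]
    rintro F ⟨i, -, rfl⟩
    exact Finset.erase_subset _ _
  · simp only [Finset.mem_image]
    rintro F ⟨i, hi, rfl⟩
    rw [Finset.card_erase_of_mem hi]
    simp
  · simp only [Finset.mem_image]
    rintro F ⟨i, hi, rfl⟩ j hj
    obtain ⟨hji, hj⟩ := Finset.mem_erase.1 hj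
    refine ⟨_, ⟨j, hj, rfl⟩, fun h => ?_, ?_, ?_⟩
    · have := Finset.mem_erase.2 ⟨hji, hj⟩
      rw [← h] at this
      simp at this
    · intro k hk
      simp only [Finset.mem_erase] at hk ⊢
      exact ⟨hk.1, hk.2.2⟩
    · rintro N' ⟨k, hk, rfl⟩ hne hsub
      have hki : k ≠ i := by
        rintro rfl
        exact hne rfl
      by_contra hkj
      have hkj : k ≠ j := by
        rintro rfl
        exact hkj rfl
      have := hsub (Finset.mem_erase.2 ⟨hkj, Finset.mem_erase.2 ⟨hki, hk⟩⟩)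
      simp at this

/-- Neighbors after stacking: an old facet keeps its neighbor, unless this was `F`, which is
replaced by the cone over the common ridge. The cone over `F.erase j` meets the former neighbor of
`F` across the ridge opposite to `n`, and the cone over `F.erase i` across the ridge opposite to
`i`. -/
theorem stack (hd : 1 ≤ d) (h : IsPseudomanifold d V 𝓕) (hF : F ∈ 𝓕) (hn : n ∉ V) :
    IsPseudomanifold d (insert n V) (stackFacets 𝓕 F n) := by
  have hnF := h.notMem hF hn
  refine ⟨?_, ?_, ?_, ?_⟩
  · obtain ⟨i, hi⟩ : F.Nonempty := Finset.card_pos.1 (by rw [h.card F hF]; omega)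
    exact ⟨_, mem_stackFacets.2 (Or.inr ⟨i, hi, rfl⟩)⟩
  · intro G hG
    rcases mem_stackFacets.1 hG with ⟨hG, -⟩ | ⟨i, hi, rfl⟩
    · exact (h.subset G hG).trans (Finset.subset_insert _ _)
    · exact Finset.insert_subset_insert _ ((Finset.erase_subset _ _).trans (h.subset F hF))
  · intro G hG
    rcases mem_stackFacets.1 hG with ⟨hG, -⟩ | ⟨i, hi, rfl⟩
    · exact h.card G hG
    · rw [Finset.card_insert_of_notMem fun hc => hnF (Finset.mem_of_mem_erase hc),
        Finset.card_erase_of_mem hi, h.card F hF]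
      omega
  · intro G hG' i hi'
    rcases mem_stackFacets.1 hG' with ⟨hG, hGF⟩ | ⟨j, hj, rfl⟩
    · have hnG := h.notMem hG hn
      obtain ⟨N, hN, hNG, hsub, huniq⟩ := h.neighbor G hG i hi'
      have hsub' : ∀ {j}, G.erase i ⊆ insert n (F.erase j) → G.erase i ⊆ F.erase j := by
        intro j hj
        rwa [Finset.subset_insert_iff_of_notMem
          fun hc => hnG (Finset.mem_of_mem_erase hc)] at hj
      by_cases hNF : N = F
      · subst hNF
        obtain ⟨j, hj, hjeq⟩ : ∃ j ∈ N, N.erase j = G.erase i := by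
          obtain ⟨j, hj, hjeq⟩ := Finset.exists_eq_insert_iff.2
            ⟨hsub, by rw [Finset.card_erase_of_mem hi', h.card G hG, h.card N hN]; omega⟩
          refine ⟨j, hjeq ▸ Finset.mem_insert_self _ _, ?_⟩
          rw [← hjeq, Finset.erase_insert hj]
        refine ⟨_, mem_stackFacets.2 (Or.inr ⟨j, hj, rfl⟩), ?_, ?_, ?_⟩
        · rintro rfl
          exact hnG (Finset.mem_insert_self _ _)
        · rw [← hjeq]
          exact Finset.subset_insert _ _
        · intro N' hN' hne hs
          rcases mem_stackFacets.1 hN' with ⟨hN', hN'F⟩ | ⟨j', hj', rfl⟩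
          · exact absurd (huniq N' hN' hne hs) hN'F
          · rw [← hjeq] at hs
            rw [eq_of_erase_subset_insert hnF hj' hs]
      · refine ⟨N, mem_stackFacets.2 (Or.inl ⟨hN, hNF⟩), hNG, hsub, ?_⟩
        intro N' hN' hne hs
        rcases mem_stackFacets.1 hN' with ⟨hN', hN'F⟩ | ⟨j', hj', rfl⟩
        · exact huniq N' hN' hne hs
        · exact absurd (huniq F hF (Ne.symm hGF)
            ((hsub' hs).trans (Finset.erase_subset _ _))).symm hNF
    · rcases Finset.mem_insert.1 hi' with rfl | hi
      · rw [Finset.erase_insert fun hc => hnF (Finset.mem_of_mem_erase hc)]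
        obtain ⟨N, hN, hNG, hsub, huniq⟩ := h.neighbor F hF j hj
        refine ⟨N, mem_stackFacets.2 (Or.inl ⟨hN, hNG⟩), ?_, hsub, ?_⟩
        · rintro rfl
          exact h.notMem hN hn (Finset.mem_insert_self _ _)
        · intro N' hN' hne hs
          rcases mem_stackFacets.1 hN' with ⟨hN', hN'F⟩ | ⟨j', hj', rfl⟩
          · exact huniq N' hN' hN'F hs
          · rw [eq_of_erase_subset_insert hnF hj' hs] at hne
            exact absurd rfl hne
      · obtain ⟨hij, hi⟩ := Finset.mem_erase.1 hi
        have hin : i ≠ n := by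
          rintro rfl
          exact hnF hi
        refine ⟨_, mem_stackFacets.2 (Or.inr ⟨i, hi, rfl⟩), ?_, ?_, ?_⟩
        · intro heq
          have : i ∈ insert n (F.erase j) :=
            Finset.mem_insert_of_mem (Finset.mem_erase.2 ⟨hij, hi⟩)
          rw [← heq] at this
          simp [hin] at this
        · intro k hk
          simp only [Finset.mem_erase, Finset.mem_insert] at hk ⊢
          tauto
        · intro N' hN' hne hs
          rcases mem_stackFacets.1 hN' with ⟨hN', hN'F⟩ | ⟨j', hj', rfl⟩
          · refine absurd (hs (Finset.mem_erase.2 ⟨hin.symm, Finset.mem_insert_self _ _⟩)) ?_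
            exact h.notMem hN' hn
          · by_cases hj'i : j' = i
            · rw [hj'i]
            · have hj'j : j' ≠ j := by
                rintro rfl
                exact hne rfl
              have := hs (Finset.mem_erase.2 ⟨hj'i, Finset.mem_insert_of_mem
                (Finset.mem_erase.2 ⟨hj'j, hj'⟩)⟩)
              have hj'n : j' ≠ n := by
                rintro rfl
                exact hnF hj'
              simp [hj'n] at this

end IsPseudomanifold

theorem StackedComplex.isPseudomanifold {d : ℕ} (hd : 1 ≤ d) {V : Finset ℕ}
    {𝓕 : Finset (Finset ℕ)} (h : StackedComplex d V 𝓕) : IsPseudomanifold d V 𝓕 := by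
  induction h with
  | simplex => exact .simplex
  | stack V 𝓕 F n _ hF hn ih => exact ih.stack hd hF hn

end Complexes

/-! ### Geometric realizations of complexes -/

/-- The points `x i` for `i ∈ V` are the vertices of a polytope whose facets are spanned by the
members of `𝓕`, with facet-defining inequalities `0 ≤ h F`. -/
structure Realizes {d : ℕ} (x : ℕ → E d) (h : Finset ℕ → E d →ᵃ[ℝ] ℝ) (V : Finset ℕ)
    (𝓕 : Finset (Finset ℕ)) : Prop where
  zero : ∀ F ∈ 𝓕, ∀ i ∈ F, h F (x i) = 0
  pos : ∀ F ∈ 𝓕, ∀ i ∈ V, i ∉ F → 0 < h F (x i)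
  hull : ∀ y, (∀ F ∈ 𝓕, 0 ≤ h F y) → y ∈ convexHull ℝ (x '' V)

namespace Realizes

variable {d : ℕ} {x : ℕ → E d} {h : Finset ℕ → E d →ᵃ[ℝ] ℝ} {V : Finset ℕ}
  {𝓕 : Finset (Finset ℕ)}

theorem nonneg (hR : Realizes x h V 𝓕) {F : Finset ℕ} (hF : F ∈ 𝓕) {i : ℕ} (hi : i ∈ V) :
    0 ≤ h F (x i) := by
  by_cases hiF : i ∈ F
  · exact (hR.zero F hF i hiF).ge
  · exact (hR.pos F hF i hi hiF).le

theorem nonneg_of_mem (hR : Realizes x h V 𝓕) {F : Finset ℕ} (hF : F ∈ 𝓕) {y : E d}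
    (hy : y ∈ convexHull ℝ (x '' V)) : 0 ≤ h F y := by
  refine convexHull_min (t := {y | 0 ≤ h F y}) ?_ ?_ hy
  · rintro _ ⟨i, hi, rfl⟩
    exact hR.nonneg hF hi
  · exact (convex_Ici (0 : ℝ)).affine_preimage (h F)

theorem mem_iff (hR : Realizes x h V 𝓕) (y : E d) :
    y ∈ convexHull ℝ (x '' V) ↔ ∀ F ∈ 𝓕, 0 ≤ h F y :=
  ⟨fun hy _ hF => hR.nonneg_of_mem hF hy, hR.hull y⟩

theorem zero_iff (hR : Realizes x h V 𝓕) {F : Finset ℕ} (hF : F ∈ 𝓕) {i : ℕ} (hi : i ∈ V) :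
    h F (x i) = 0 ↔ i ∈ F :=
  ⟨fun h0 => by_contra fun hiF => (hR.pos F hF i hi hiF).ne' h0, hR.zero F hF i⟩

theorem simplex (hx : ∀ i ≤ d, ∀ j ≤ d, i ≠ j → h ((Finset.range (d + 1)).erase i) (x j) = 0)
    (hx' : ∀ i ≤ d, 0 < h ((Finset.range (d + 1)).erase i) (x i)) :
    Realizes x h (Finset.range (d + 1))
      ((Finset.range (d + 1)).image fun i => (Finset.range (d + 1)).erase i) := by
  simp only [← Nat.lt_succ_iff, ← Finset.mem_range, Nat.succ_eq_add_one] at hx hx'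
  refine ⟨?_, ?_, ?_⟩
  · simp only [Finset.mem_image]
    rintro F ⟨i, hi, rfl⟩ j hj
    obtain ⟨hji, hj⟩ := Finset.mem_erase.1 hj
    exact hx i hi j hj hji.symm
  · simp only [Finset.mem_image]
    rintro F ⟨i, hi, rfl⟩ j hj hji
    obtain rfl : j = i := by
      by_contra hne
      exact hji (Finset.mem_erase.2 ⟨hne, hj⟩)
    exact hx' j hi
  · intro y hy
    obtain ⟨hs, hy'⟩ := dual_sum (fun i : Finset.range (d + 1) => x i)
      (fun i => h ((Finset.range (d + 1)).erase i)) (by simp)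
      (fun k l hkl => hx k k.2 l l.2 fun he => hkl (Subtype.ext he)) (fun k => (hx' k k.2).ne') y
    rw [← hy']
    refine (convex_convexHull ℝ _).sum_mem (fun i _ => ?_) hs fun i _ =>
      subset_convexHull ℝ _ ⟨i, i.2, rfl⟩
    exact div_nonneg (hy _ (Finset.mem_image.2 ⟨i, i.2, rfl⟩)) (hx' i i.2).le

/-- Stacking a vertex `p` onto the facet `F`. -/
theorem stack (hR : Realizes x h V 𝓕) (hM : IsPseudomanifold d V 𝓕) {F : Finset ℕ} (hF : F ∈ 𝓕)
    {n : ℕ} (hn : n ∉ V) {p : E d} (hp : h F p < 0) (hp' : ∀ G ∈ 𝓕, G ≠ F → 0 < h G p)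
    {h' : Finset ℕ → E d →ᵃ[ℝ] ℝ} (hold : ∀ G ∈ 𝓕, G ≠ F → h' G = h G)
    (hnew : ∀ i ∈ F, ∀ N ∈ 𝓕, N ≠ F → F.erase i ⊆ N →
      ∃ a b : ℝ, 0 < a ∧ 0 < b ∧ h' (insert n (F.erase i)) = a • h F + b • h N)
    (hnp : ∀ i ∈ F, h' (insert n (F.erase i)) p = 0) :
    Realizes (Function.update x n p) h' (insert n V) (stackFacets 𝓕 F n) := by
  have hnF := hM.notMem hF hn
  have hxe : ∀ i ∈ V, Function.update x n p i = x i := by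
    intro i hi
    rw [Function.update_of_ne]
    rintro rfl
    exact hn hi
  have hxn : Function.update x n p n = p := Function.update_self _ _ _
  have hzero : ∀ i ∈ F, ∀ j ∈ F.erase i, h' (insert n (F.erase i)) (x j) = 0 := by
    intro i hi j hj
    obtain ⟨N, hN, hNF, hsub, -⟩ := hM.neighbor F hF i hi
    obtain ⟨a, b, ha, hb, he⟩ := hnew i hi N hN hNF hsub
    rw [he]
    simp [hR.zero F hF j (Finset.mem_of_mem_erase hj), hR.zero N hN j (hsub hj)]
  have hpos : ∀ i ∈ F, ∀ j ∈ V, j ∉ F.erase i → 0 < h' (insert n (F.erase i)) (x j) := by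
    intro i hi j hj hji
    obtain ⟨N, hN, hNF, hsub, -⟩ := hM.neighbor F hF i hi
    obtain ⟨a, b, ha, hb, he⟩ := hnew i hi N hN hNF hsub
    rw [he]
    simp only [AffineMap.coe_add, AffineMap.coe_smul, Pi.add_apply, Pi.smul_apply, smul_eq_mul]
    by_cases hjF : j ∈ F
    · obtain rfl : j = i := by
        by_contra hne
        exact hji (Finset.mem_erase.2 ⟨hne, hjF⟩)
      have := hR.pos N hN j hj (hM.notMem_of_erase_subset hF hN hNF hsub)
      rw [hR.zero F hF j hjF]
      positivity
    · have h1 := hR.pos F hF j hj hjF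
      have h2 := hR.nonneg hN hj
      positivity
  refine ⟨?_, ?_, ?_⟩
  · intro G hG j hj
    rcases mem_stackFacets.1 hG with ⟨hG, hGF⟩ | ⟨i, hi, rfl⟩
    · rw [hold G hG hGF, hxe j (hM.subset G hG hj), hR.zero G hG j hj]
    · rcases Finset.mem_insert.1 hj with rfl | hj
      · rw [hxn, hnp i hi]
      · rw [hxe j (hM.subset F hF (Finset.mem_of_mem_erase hj)), hzero i hi j hj]
  · intro G hG' j hj hjG
    rcases mem_stackFacets.1 hG' with ⟨hG, hGF⟩ | ⟨i, hi, rfl⟩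
    · rw [hold G hG hGF]
      rcases Finset.mem_insert.1 hj with rfl | hj
      · rw [hxn]
        exact hp' G hG hGF
      · rw [hxe j hj]
        exact hR.pos G hG j hj hjG
    · have hjn : j ≠ n := fun he => hjG (he ▸ Finset.mem_insert_self _ _)
      have hjV := Finset.mem_of_mem_insert_of_ne hj hjn
      rw [hxe j hjV]
      exact hpos i hi j hjV fun hc => hjG (Finset.mem_insert_of_mem hc)
  · intro y hy
    -- The hyperplane of `F` splits the new polytope into the old one and the simplex spanned by `F`
    -- and `p`.
    by_cases hyF : 0 ≤ h F y
    · refine convexHull_mono ?_ (hR.hull y fun G hG => ?_)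
      · rintro _ ⟨i, hi, rfl⟩
        exact ⟨i, Finset.mem_insert_of_mem hi, hxe i hi⟩
      · by_cases hGF : G = F
        · rwa [hGF]
        · rw [← hold G hG hGF]
          exact hy G (mem_stackFacets.2 (Or.inl ⟨hG, hGF⟩))
    · push Not at hyF
      have hFV := hM.subset F hF
      -- The vertices of that simplex are dual to `h F` and the new functionals. Since `h F` is
      -- negative both at `p` and at `y`, all barycentric coordinates of `y` are nonnegative.
      obtain ⟨hs, hy'⟩ := dual_sum (fun i : Option F => i.elim p fun i => x i)
        (fun i => i.elim (h F) fun i => h' (insert n (F.erase i))) (by simp [hM.card F hF])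
        (by
          rintro (_ | k) (_ | l) hkl
          · exact absurd rfl hkl
          · exact hR.zero F hF l l.2
          · exact hnp k k.2
          · refine hzero k k.2 l (Finset.mem_erase.2 ⟨fun he => hkl ?_, l.2⟩)
            rw [Subtype.ext he])
        (by
          rintro (_ | k)
          · exact hp.ne
          · exact (hpos k k.2 k (hFV k.2) (by simp)).ne') y
      rw [← hy']
      refine (convex_convexHull ℝ _).sum_mem ?_ hs ?_
      · rintro (_ | i) -
        · exact div_nonneg_of_nonpos hyF.le hp.le
        · exact div_nonneg (hy _ (mem_stackFacets.2 (Or.inr ⟨i, i.2, rfl⟩)))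
            (hpos i i.2 i (hFV i.2) (by simp)).le
      · rintro (_ | i) -
        · exact subset_convexHull ℝ _ ⟨n, Finset.mem_coe.2 (Finset.mem_insert_self _ _), hxn⟩
        · exact subset_convexHull ℝ _
            ⟨i, Finset.mem_coe.2 (Finset.mem_insert_of_mem (hFV i.2)), hxe i (hFV i.2)⟩

end Realizes

/-- As `n ∉ F`, the index `i ∈ F` can be recovered from the cone over `F.erase i`, so values may be
prescribed on the cones independently. -/
theorem exists_extend_to_stackFacets {A : Type*} (F : Finset ℕ) {n : ℕ} (hn : n ∉ F)
    (h : Finset ℕ → A) (u : ℕ → A) :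
    ∃ h' : Finset ℕ → A, (∀ G, n ∉ G → h' G = h G) ∧
      ∀ i ∈ F, h' (insert n (F.erase i)) = u i := by
  classical
  refine ⟨fun G => if hG : ∃ i ∈ F, insert n (F.erase i) = G then u hG.choose else h G, ?_, ?_⟩
  · intro G hG
    refine dif_neg ?_
    rintro ⟨i, -, rfl⟩
    exact hG (Finset.mem_insert_self _ _)
  · intro i hi
    have hex : ∃ j ∈ F, insert n (F.erase j) = insert n (F.erase i) := ⟨i, hi, rfl⟩
    have hj := hex.choose_spec
    refine (dif_pos hex).trans (congrArg u ?_)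
    refine (eq_of_erase_subset_insert hn hi ?_).symm
    exact (Finset.subset_insert n _).trans hj.2.le

namespace IsPseudomanifold

variable {d : ℕ} {V : Finset ℕ} {𝓕 : Finset (Finset ℕ)}

theorem exists_facet_notMem (hM : IsPseudomanifold d V 𝓕) (i : ℕ) :
    ∃ F ∈ 𝓕, i ∉ F := by
  obtain ⟨F, hF⟩ := hM.nonempty
  by_cases hi : i ∈ F
  · obtain ⟨N, hN, hNF, hsub, -⟩ := hM.neighbor F hF i hi
    exact ⟨N, hN, hM.notMem_of_erase_subset hF hN hNF hsub⟩
  · exact ⟨F, hF, hi⟩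

theorem facet_nonempty (hd : 1 ≤ d) (hM : IsPseudomanifold d V 𝓕) {F : Finset ℕ} (hF : F ∈ 𝓕) :
    F.Nonempty :=
  Finset.card_pos.1 (by rw [hM.card F hF]; omega)

theorem exists_vertex_notMem (hd : 1 ≤ d) (hM : IsPseudomanifold d V 𝓕) {F : Finset ℕ}
    (hF : F ∈ 𝓕) : ∃ i ∈ V, i ∉ F := by
  obtain ⟨i, hi⟩ := hM.facet_nonempty hd hF
  obtain ⟨N, hN, hNF, -⟩ := hM.neighbor F hF i hi
  by_contra! hcon
  exact hNF (hM.eq_of_subset hN hF fun j hj => hcon j (hM.subset N hN hj))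

/-- A choice of neighbors of the facet `F`. -/
theorem exists_neighbors (hM : IsPseudomanifold d V 𝓕) {F : Finset ℕ} (hF : F ∈ 𝓕) :
    ∃ N : ℕ → Finset ℕ, (∀ i ∈ F, N i ∈ 𝓕 ∧ N i ≠ F ∧ F.erase i ⊆ N i ∧ i ∉ N i) ∧
      ∀ i ∈ F, ∀ N' ∈ 𝓕, N' ≠ F → F.erase i ⊆ N' → N' = N i := by
  have := hM.neighbor F hF
  choose! N hN hNF hsub huniq using this
  exact ⟨N, fun i hi => ⟨hN i hi, hNF i hi, hsub i hi,
    hM.notMem_of_erase_subset hF (hN i hi) (hNF i hi) (hsub i hi)⟩, huniq⟩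

end IsPseudomanifold

/-! ### Facets and faces of a realized complex -/

namespace Realizes

variable {d : ℕ} {x : ℕ → E d} {h : Finset ℕ → E d →ᵃ[ℝ] ℝ} {V : Finset ℕ}
  {𝓕 : Finset (Finset ℕ)}

theorem nonempty_faceLattice_equiv (hM : IsPseudomanifold d V 𝓕)
    (hR : Realizes x h V 𝓕) :
    Nonempty (FaceLattice (convexHull ℝ (x '' V)) ≃o
      Concept V 𝓕 (fun i F => i.1 ∈ F.1)) := by
  have hr : (fun (i : V) (F : 𝓕) => h F (x i) = 0) = fun i F => i.1 ∈ F.1 := by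
    funext i F
    exact propext (hR.zero_iff F.2 i.2)
  have hrange : Set.range (fun i : V => x i) = x '' V := by
    ext
    simp
  have := nonempty_faceLattice_equiv_concept (fun i : V => x i) (fun F : 𝓕 => h F)
    (fun y => by
      rw [hrange, hR.mem_iff]
      simp)
    (fun i => by
      obtain ⟨F, hF, hiF⟩ := hM.exists_facet_notMem i
      exact ⟨⟨F, hF⟩, fun h0 => hiF ((hR.zero_iff hF i.2).1 h0)⟩)
  rwa [hrange, hr] at this

section Expansion

variable (hM : IsPseudomanifold d V 𝓕) (hR : Realizes x h V 𝓕) {F : Finset ℕ} (hF : F ∈ 𝓕)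
  {N : ℕ → Finset ℕ} (hN : ∀ i ∈ F, N i ∈ 𝓕 ∧ N i ≠ F ∧ F.erase i ⊆ N i ∧ i ∉ N i)
  {o : E d} (ho : h F o ≠ 0)

include hM hR hF hN ho

/-- The functional of the neighbor `N i` vanishes at all vertices of `F` except `x i`. Subtracting a
multiple of `h F` makes it vanish at `o` as well without changing its values on `F`. This yields the
coordinates used in `expansion`. -/
theorem facet_dual :
    (∀ k l : Option F, k ≠ l →
      (k.elim (h F) fun i => h (N i) - (h (N i) o / h F o) • h F)
        (l.elim o fun i => x i) = 0) ∧
    (∀ k : Option F,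
      (k.elim (h F) fun i => h (N i) - (h (N i) o / h F o) • h F)
        (k.elim o fun i => x i) ≠ 0) := by
  constructor
  · rintro (_ | k) (_ | l) hkl
    · exact absurd rfl hkl
    · exact hR.zero F hF l l.2
    · simp [ho]
    · have : l.1 ∈ N k := (hN k k.2).2.2.1
        (Finset.mem_erase.2 ⟨fun he => hkl (by rw [Subtype.ext he]), l.2⟩)
      simp [hR.zero F hF l l.2, hR.zero (N k) (hN k k.2).1 l this]
  · rintro (_ | k)
    · exact ho
    · have := hR.pos (N k) (hN k k.2).1 k (hM.subset F hF k.2) (hN k k.2).2.2.2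
      simp [hR.zero F hF k k.2, this.ne']

theorem affineIndependent_option :
    AffineIndependent ℝ (fun i : Option F => i.elim o fun i => x i) := by
  obtain ⟨h0, h1⟩ := facet_dual hM hR hF hN ho
  exact affineIndependent_of_dual _ _ h0 h1

theorem expansion (k : E d →ᵃ[ℝ] ℝ) (y : E d) :
    k y = h F y / h F o * k o +
      ∑ i ∈ F, (h (N i) y - h (N i) o / h F o * h F y) / h (N i) (x i) * k (x i) := by
  obtain ⟨h0, h1⟩ := facet_dual hM hR hF hN ho
  have := dual_expansion _ _ (by simp [hM.card F hF]) h0 h1 k y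
  rw [this, Fintype.sum_option, ← Finset.sum_coe_sort F]
  congr 1
  refine Finset.sum_congr rfl fun i _ => ?_
  simp [hR.zero F hF i i.2]

end Expansion

theorem mem_convexHull_of_mem_face {G : Set (E d)}
    (hG : IsExposed ℝ (convexHull ℝ (x '' V)) G) {y : E d} (hy : y ∈ G) :
    y ∈ convexHull ℝ (x '' {i | i ∈ V ∧ x i ∈ G}) := by
  have hrange : Set.range (fun i : V => x i) = x '' V := by
    ext
    simp
  rw [← hrange] at hG
  obtain ⟨w, hw, hw1, rfl, hwG⟩ := mem_convexHull_of_isExposed _ hG hy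
  rw [← Finset.sum_filter_of_ne (p := fun a => w a ≠ 0)
    (fun a _ ha h0 => ha (by rw [h0, zero_smul]))]
  refine (convex_convexHull ℝ _).sum_mem (fun a _ => hw a) ?_ fun a ha =>
    subset_convexHull ℝ _ ⟨a, ⟨a.2, hwG a (Finset.mem_filter.1 ha).2⟩, rfl⟩
  rw [Finset.sum_filter_ne_zero, hw1]

theorem isExposed_facet (hR : Realizes x h V 𝓕) {F : Finset ℕ} (hF : F ∈ 𝓕) :
    IsExposed ℝ (convexHull ℝ (x '' V)) {y ∈ convexHull ℝ (x '' V) | h F y = 0} :=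
  isExposed_of_affineMap _ fun _ hy => hR.nonneg_of_mem hF hy

theorem facet_eq (hM : IsPseudomanifold d V 𝓕) (hR : Realizes x h V 𝓕) {F : Finset ℕ}
    (hF : F ∈ 𝓕) : {y ∈ convexHull ℝ (x '' V) | h F y = 0} = convexHull ℝ (x '' F) := by
  refine subset_antisymm (fun y hy => ?_) (convexHull_min ?_ ?_)
  · refine convexHull_mono (Set.image_mono ?_) (mem_convexHull_of_mem_face (hR.isExposed_facet hF) hy)
    rintro i ⟨hi, -, h0⟩
    exact (hR.zero_iff hF hi).1 h0
  · rintro _ ⟨i, hi, rfl⟩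
    exact ⟨subset_convexHull ℝ _ ⟨i, hM.subset F hF hi, rfl⟩, hR.zero F hF i hi⟩
  · exact (convex_convexHull ℝ _).inter ((convex_singleton (0 : ℝ)).affine_preimage (h F))

theorem isFacet (hd : 1 ≤ d) (hM : IsPseudomanifold d V 𝓕) (hR : Realizes x h V 𝓕)
    {F : Finset ℕ} (hF : F ∈ 𝓕) :
    IsFacet (convexHull ℝ (x '' V)) {y ∈ convexHull ℝ (x '' V) | h F y = 0} := by
  refine ⟨hR.isExposed_facet hF, ?_, ?_⟩
  · rw [hR.facet_eq hM hF, convexHull_nonempty_iff]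
    exact (hM.facet_nonempty hd hF).to_set.image x
  · obtain ⟨o, hoV, hoF⟩ := hM.exists_vertex_notMem hd hF
    obtain ⟨N, hN, -⟩ := hM.exists_neighbors hF
    have hind := (affineIndependent_option hM hR hF hN (hR.pos F hF o hoV hoF).ne').comp_embedding
      Function.Embedding.some
    have := hind.finrank_vectorSpan (n := d - 1) (by simp [hM.card F hF]; omega)
    have hrange : Set.range ((fun i : Option F => i.elim (x o) fun i => x i) ∘
        (Function.Embedding.some : F ↪ Option F)) = x '' F := by
      ext
      simp
    rw [hrange] at this
    rw [hR.facet_eq hM hF, ← direction_affineSpan, affineSpan_convexHull, direction_affineSpan,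
      this]
    omega

/-- Compare the vertices in `G` with the members of the complex: either some member contains them
all, and dimension forces equality, or no inequality is tight on all of them and `G` is too large.
-/
theorem exists_eq_facet (hd : 1 ≤ d) (hM : IsPseudomanifold d V 𝓕) (hR : Realizes x h V 𝓕)
    {G : Set (E d)} (hG : IsFacet (convexHull ℝ (x '' V)) G) :
    ∃ F ∈ 𝓕, G = {y ∈ convexHull ℝ (x '' V) | h F y = 0} := by
  classical
  set A := V.filter fun i => x i ∈ G with hA
  have hAG : (A : Set ℕ) = {i | i ∈ V ∧ x i ∈ G} := by
    ext
    simp [hA]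
  have hGA : ∀ y ∈ G, y ∈ convexHull ℝ (x '' A) := fun y hy => by
    rw [hAG]
    exact mem_convexHull_of_mem_face hG.exposed hy
  have hrange : Set.range (fun i : V => x i) = x '' V := by
    ext
    simp
  have hconv : Convex ℝ G := hG.exposed.convex (convex_convexHull ℝ _)
  by_cases hex : ∃ F ∈ 𝓕, A ⊆ F
  · obtain ⟨F, hF, hAF⟩ := hex
    have hAne : A.Nonempty := by
      obtain ⟨y, hy⟩ := hG.nonempty
      have := convexHull_nonempty_iff.1 ⟨y, hGA y hy⟩
      exact Finset.coe_nonempty.1 this.of_image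
    obtain ⟨m, hm⟩ := Nat.exists_eq_succ_of_ne_zero hAne.card_pos.ne'
    have hle := finrank_vectorSpan_image_finset_le ℝ x A hm
    have hspan : vectorSpan ℝ G ≤ vectorSpan ℝ (A.image x : Set (E d)) := by
      rw [Finset.coe_image, ← direction_affineSpan ℝ (x '' A), ← affineSpan_convexHull,
        direction_affineSpan]
      exact vectorSpan_mono ℝ hGA
    have hle' := Submodule.finrank_mono hspan
    have hdim := hG.dim_eq
    -- The points of `A` span a space of dimension at most `A.card - 1`, while `G` has dimension `d
    -- - 1`.
    obtain rfl : A = F := Finset.eq_of_subset_of_card_le hAF (by rw [hM.card F hF]; omega)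
    refine ⟨A, hF, ?_⟩
    rw [hR.facet_eq hM hF]
    refine subset_antisymm hGA (convexHull_min ?_ hconv)
    rintro _ ⟨i, hi, rfl⟩
    exact (Finset.mem_filter.1 hi).2
  · exfalso
    push Not at hex
    -- The hypothesis of `mem_face_of_incident` holds vacuously. Then `G` contains `d + 1` affinely
    -- independent points, contradicting its dimension.
    have hall : ∀ i ∈ V, x i ∈ G := by
      intro i hi
      refine mem_face_of_incident (fun i : V => x i) (fun F : 𝓕 => h F) (fun y => ?_)
        (fun i => ?_) (by rw [hrange]; exact hG.exposed) (a := ⟨i, hi⟩) ?_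
      · rw [hrange, hR.mem_iff]
        simp
      · obtain ⟨F, hF, hiF⟩ := hM.exists_facet_notMem i
        exact ⟨⟨F, hF⟩, fun h0 => hiF ((hR.zero_iff hF i.2).1 h0)⟩
      · intro F hFz
        refine absurd (fun j hj => ?_) (hex F F.2)
        have hj := Finset.mem_filter.1 hj
        exact (hR.zero_iff F.2 hj.1).1 (hFz ⟨j, hj.1⟩ hj.2)
    obtain ⟨F, hF⟩ := hM.nonempty
    obtain ⟨o, hoV, hoF⟩ := hM.exists_vertex_notMem hd hF
    obtain ⟨N, hN, -⟩ := hM.exists_neighbors hF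
    have hind := affineIndependent_option hM hR hF hN (hR.pos F hF o hoV hoF).ne'
    have h1 := hind.finrank_vectorSpan (n := d) (by simp [hM.card F hF])
    have h2 := Submodule.finrank_mono (vectorSpan_mono ℝ (s₂ := G) (by
      rintro _ ⟨(_ | i), rfl⟩
      · exact hall o hoV
      · exact hall i (hM.subset F hF i.2)) :
        vectorSpan ℝ (Set.range fun i : Option F => i.elim (x o) fun i => x i) ≤ _)
    have := hG.dim_eq
    omega

/-- The facet-defining inequality of a facet is unique up to a positive factor. -/
theorem exists_eq_mul (hd : 1 ≤ d) (hM : IsPseudomanifold d V 𝓕) (hR : Realizes x h V 𝓕)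
    {F : Finset ℕ} (hF : F ∈ 𝓕) (k : E d →ᵃ[ℝ] ℝ)
    (hk : ∀ y ∈ convexHull ℝ (x '' V), 0 ≤ k y)
    (hkF : {y ∈ convexHull ℝ (x '' V) | h F y = 0} = {y ∈ convexHull ℝ (x '' V) | k y = 0}) :
    ∃ c : ℝ, 0 < c ∧ ∀ y, k y = c * h F y := by
  obtain ⟨o, hoV, hoF⟩ := hM.exists_vertex_notMem hd hF
  obtain ⟨N, hN, -⟩ := hM.exists_neighbors hF
  have ho := hR.pos F hF o hoV hoF
  have hoP : x o ∈ convexHull ℝ (x '' V) := subset_convexHull ℝ _ ⟨o, hoV, rfl⟩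
  have hko : 0 < k (x o) := by
    refine lt_of_le_of_ne (hk _ hoP) fun h0 => ho.ne' ?_
    have : x o ∈ {y ∈ convexHull ℝ (x '' V) | k y = 0} := ⟨hoP, h0.symm⟩
    rw [← hkF] at this
    exact this.2
  refine ⟨k (x o) / h F (x o), by positivity, fun y => ?_⟩
  rw [expansion hM hR hF hN ho.ne' k y, Finset.sum_eq_zero fun i hi => ?_]
  · ring
  · have : x i ∈ {y ∈ convexHull ℝ (x '' V) | h F y = 0} :=
      ⟨subset_convexHull ℝ _ ⟨i, hM.subset F hF hi, rfl⟩, hR.zero F hF i hi⟩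
    rw [hkF] at this
    rw [this.2, mul_zero]

end Realizes

/-! ### From stacked polytopes to stacked complexes -/

theorem exists_affineMap_eq_sub {d : ℕ} (l : E d →L[ℝ] ℝ) (c : ℝ) :
    ∃ k : E d →ᵃ[ℝ] ℝ, ∀ y, k y = c - l y :=
  ⟨AffineMap.const ℝ (E d) c - l.toLinearMap.toAffineMap, fun y => by simp⟩

theorem convexHull_insert_stack {d : ℕ} (x : ℕ → E d) {V : Finset ℕ} {n : ℕ} (hn : n ∉ V)
    (p : E d) : convexHull ℝ (insert p (convexHull ℝ (x '' V))) =
      convexHull ℝ (Function.update x n p '' (insert n V : Finset ℕ)) := by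
  have h1 : Function.update x n p '' (insert n V : Finset ℕ) = insert p (x '' V) := by
    rw [Finset.coe_insert, Set.image_insert_eq, Function.update_self]
    congr 1
    refine Set.image_congr fun i hi => Function.update_of_ne ?_ _ _
    rintro rfl
    exact hn hi
  rw [h1, Set.insert_eq, convexHull_convexHull_union_right, ← Set.insert_eq]

theorem exists_realizes_simplex {d : ℕ} (P : Set (E d)) (hP : IsSimplex d P) :
    ∃ x h, Realizes x h (Finset.range (d + 1))
      ((Finset.range (d + 1)).image fun i => (Finset.range (d + 1)).erase i) ∧
      P = convexHull ℝ (x '' (Finset.range (d + 1) : Finset ℕ)) := by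
  obtain ⟨s, rfl⟩ := hP
  have htop : affineSpan ℝ (Set.range s.points) = ⊤ := by
    rw [s.independent.affineSpan_eq_top_iff_card_eq_finrank_add_one]
    simp
  let b : AffineBasis (Fin (d + 1)) ℝ (E d) := ⟨s.points, s.independent, htop⟩
  let x : ℕ → E d := fun i => s.points (Fin.ofNat (d + 1) i)
  -- On a facet of the simplex only the summand of the missing index survives.
  let h : Finset ℕ → E d →ᵃ[ℝ] ℝ := fun F => ∑ i : Fin (d + 1), if i.1 ∈ F then 0 else b.coord i
  have hh : ∀ i : Fin (d + 1), h ((Finset.range (d + 1)).erase i) = b.coord i := by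
    intro i
    simp only [h]
    rw [Finset.sum_eq_single i]
    · simp
    · intro j _ hji
      rw [if_pos]
      exact Finset.mem_erase.2 ⟨fun he => hji (Fin.ext he), Finset.mem_range.2 j.2⟩
    · simp
  have hx : ∀ i : Fin (d + 1), x i = b i := by
    intro i
    change s.points _ = s.points i
    simp
  refine ⟨x, h, Realizes.simplex ?_ ?_, ?_⟩
  · intro i hi j hj hij
    have h1 := hh ⟨i, by omega⟩
    have h2 := hx ⟨j, by omega⟩
    simp only at h1 h2
    rw [h1, h2, b.coord_apply_ne]
    simpa using hij
  · intro i hi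
    have h1 := hh ⟨i, by omega⟩
    have h2 := hx ⟨i, by omega⟩
    simp only at h1 h2
    rw [h1, h2, b.coord_apply_eq]
    exact one_pos
  · congr 1
    ext y
    constructor
    · rintro ⟨i, rfl⟩
      exact ⟨i, Finset.mem_coe.2 (Finset.mem_range.2 i.2), hx i⟩
    · rintro ⟨i, -, rfl⟩
      exact ⟨_, rfl⟩

/-- Every stacked polytope realizes a stacked complex. -/
theorem IsStacked.exists_realizes {d : ℕ} (hd : 1 ≤ d) {S : Set (E d)} (hS : IsStacked S) :
    ∃ V 𝓕, StackedComplex d V 𝓕 ∧ ∃ x h, Realizes x h V 𝓕 ∧ S = convexHull ℝ (x '' V) := by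
  induction hS with
  | simplex P hP =>
    obtain ⟨x, h, hR, hPx⟩ := exists_realizes_simplex P hP
    exact ⟨_, _, .simplex, x, h, hR, hPx⟩
  | stack P F p _ hp ih =>
    obtain ⟨V, 𝓕, hC, x, h, hR, rfl⟩ := ih
    have hM := hC.isPseudomanifold hd
    obtain ⟨F, hF, rfl⟩ := hR.exists_eq_facet hd hM hp.facet
    obtain ⟨n, hn⟩ := V.exists_notMem
    have hpF : h F p < 0 := by
      obtain ⟨l, c, hle, heq, hlt⟩ := hp.beyond
      obtain ⟨k, hk⟩ := exists_affineMap_eq_sub l c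
      obtain ⟨r, hr, hkr⟩ := hR.exists_eq_mul hd hM hF k
        (fun y hy => by rw [hk]; exact sub_nonneg.2 (hle y hy))
        (by rw [heq]; simp_rw [hk, sub_eq_zero, eq_comm])
      have h1 := hkr p
      rw [hk] at h1
      nlinarith
    have hpG : ∀ G ∈ 𝓕, G ≠ F → 0 < h G p := by
      intro G hG hGF
      obtain ⟨l, c, hle, heq, hlt⟩ := hp.beneath _ (hR.isFacet hd hM hG) (by
        intro he
        refine hGF (hM.eq_of_subset hG hF fun i hi => ?_)
        have hi' : x i ∈ {y ∈ convexHull ℝ (x '' V) | h G y = 0} :=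
          ⟨subset_convexHull ℝ _ ⟨i, hM.subset G hG hi, rfl⟩, hR.zero G hG i hi⟩
        rw [he] at hi'
        exact (hR.zero_iff hF (hM.subset G hG hi)).1 hi'.2)
      obtain ⟨k, hk⟩ := exists_affineMap_eq_sub l c
      obtain ⟨r, hr, hkr⟩ := hR.exists_eq_mul hd hM hG k
        (fun y hy => by rw [hk]; exact sub_nonneg.2 (hle y hy))
        (by rw [heq]; simp_rw [hk, sub_eq_zero, eq_comm])
      have h1 := hkr p
      rw [hk] at h1
      by_contra hcon
      nlinarith
    obtain ⟨N, hN, huniq⟩ := hM.exists_neighbors hF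
    -- The hyperplane through a ridge of `F` and `p` belongs to the pencil of `h F` and `h (N i)`.
    -- These coefficients make the combination vanish at `p`, and they are positive because `p` is
    -- beyond `F` and beneath `N i`.
    obtain ⟨h', hold, hnew⟩ := exists_extend_to_stackFacets F (hM.notMem hF hn) h
      fun i => h (N i) p • h F + (-h F p) • h (N i)
    refine ⟨_, _, .stack V 𝓕 F n hC hF hn, Function.update x n p, h',
      hR.stack hM hF hn hpF hpG (fun G hG _ => hold G (hM.notMem hG hn)) ?_ ?_,
      convexHull_insert_stack x hn p⟩
    · intro i hi N' hN' hN'F hsub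
      obtain rfl := huniq i hi N' hN' hN'F hsub
      exact ⟨_, _, hpG _ hN' hN'F, neg_pos.2 hpF, hnew i hi⟩
    · intro i hi
      rw [hnew i hi]
      simp
      ring

/-! ### Facet normals and truncation of the polar polytope -/

/-- The affine functional `y ↦ 1 - ⟪u, y⟫`. -/
noncomputable def oneSub {d : ℕ} (u : E d) : E d →ᵃ[ℝ] ℝ :=
  AffineMap.const ℝ (E d) 1 - (innerSL ℝ u).toLinearMap.toAffineMap

@[simp]
theorem oneSub_apply {d : ℕ} (u y : E d) : oneSub u y = 1 - inner ℝ u y := by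
  simp [oneSub]

theorem oneSub_lineMap {d : ℕ} (u u' : E d) (t : ℝ) :
    oneSub (AffineMap.lineMap u u' t) = (1 - t) • oneSub u + t • oneSub u' := by
  ext y
  simp only [oneSub_apply, AffineMap.coe_add, AffineMap.coe_smul, Pi.add_apply, Pi.smul_apply,
    smul_eq_mul, AffineMap.lineMap_apply_module, inner_add_left, inner_smul_left,
    RCLike.conj_to_real]
  ring

theorem oneSub_lineMap_apply {d : ℕ} (u u' y : E d) (t : ℝ) :
    oneSub (AffineMap.lineMap u u' t) y = (1 - t) * oneSub u y + t * oneSub u' y := by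
  rw [oneSub_lineMap]
  rfl

/-- A realization of the complex `(V, 𝓕)` with facet normals `v F`, polar to a polytope with
vertices `v F`. The vertices marked by `out` lie outside of `K`, the other ones on its boundary, all
edges of the polar polytope meet the interior of `K`, and the origin is in the interior of the
convex hull of the intersections of these edges with `K`. -/
structure Scribes {d : ℕ} (K : Set (E d)) (out : Finset ℕ → Prop) (x : ℕ → E d)
    (v : Finset ℕ → E d) (V : Finset ℕ) (𝓕 : Finset (Finset ℕ)) : Prop where
  realizes : Realizes x (fun F => oneSub (v F)) V 𝓕
  outside : ∀ F ∈ 𝓕, out F → v F ∉ K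
  frontier : ∀ F ∈ 𝓕, ¬ out F → v F ∈ frontier K
  edge : ∀ F ∈ 𝓕, ∀ G ∈ 𝓕, (F ∩ G).card + 1 = d →
    ∃ t ∈ Set.Icc (0 : ℝ) 1, AffineMap.lineMap (v F) (v G) t ∈ interior K
  core : ∀ z : E d, z ≠ 0 → ∃ F ∈ 𝓕, ∃ G ∈ 𝓕, (F ∩ G).card + 1 = d ∧
    ∃ t ∈ Set.Icc (0 : ℝ) 1, AffineMap.lineMap (v F) (v G) t ∈ K ∧
      0 < inner ℝ z (AffineMap.lineMap (v F) (v G) t)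

/-- Take the least parameter at which the segment is in the closed set `K`. It is positive since `u
∉ K`, and its point is not interior, as otherwise slightly smaller parameters would do. -/
theorem exists_exit {d : ℕ} {K : Set (E d)} (hK : IsClosed K) {u u' : E d} (hu : u ∉ K) {s : ℝ}
    (hs : s ∈ Set.Icc (0 : ℝ) 1) (hsK : AffineMap.lineMap u u' s ∈ interior K) :
    ∃ t, 0 < t ∧ t < s ∧ AffineMap.lineMap u u' t ∈ frontier K ∧
      ∀ r ∈ Set.Icc (0 : ℝ) 1, AffineMap.lineMap u u' r ∈ K → t ≤ r := by
  have hcont : Continuous fun r : ℝ => (AffineMap.lineMap u u' r : E d) :=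
    AffineMap.lineMap_continuous
  obtain ⟨t, ⟨ht, htK⟩, hmin⟩ : ∃ t, IsLeast
      (Set.Icc (0 : ℝ) 1 ∩ (fun r : ℝ => (AffineMap.lineMap u u' r : E d)) ⁻¹' K) t :=
    (isCompact_Icc.inter_right (hK.preimage hcont)).exists_isLeast ⟨s, hs, interior_subset (s := K) hsK⟩
  have ht0 : 0 < t := by
    refine lt_of_le_of_ne ht.1 ?_
    rintro rfl
    simp only [Set.mem_preimage, AffineMap.lineMap_apply_zero] at htK
    exact hu htK
  have htint : AffineMap.lineMap u u' t ∉ interior K := by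
    intro hti
    have hnhds : ∀ᶠ r in nhds t, AffineMap.lineMap u u' r ∈ interior K :=
      (isOpen_interior.preimage hcont).mem_nhds hti
    have h2 : ∀ᶠ r in nhdsWithin t (Set.Iio t), r ∈ Set.Ioo 0 t := Ioo_mem_nhdsLT ht0
    obtain ⟨r, hr, hr0⟩ := ((hnhds.filter_mono nhdsWithin_le_nhds).and h2).exists
    have := hmin ⟨⟨hr0.1.le, hr0.2.le.trans ht.2⟩, interior_subset (s := K) hr⟩
    exact absurd hr0.2 (not_lt.2 this)
  refine ⟨t, ht0, lt_of_le_of_ne (hmin ⟨hs, interior_subset (s := K) hsK⟩) ?_, ?_, fun r hr hrK =>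
    hmin ⟨hr, hrK⟩⟩
  · rintro rfl
    exact htint hsK
  · exact ⟨subset_closure htK, htint⟩

namespace IsPseudomanifold

variable {d : ℕ} {V : Finset ℕ} {𝓕 : Finset (Finset ℕ)}

theorem exists_erase_subset (hM : IsPseudomanifold d V 𝓕) {F G : Finset ℕ} (hF : F ∈ 𝓕)
    (hFG : (F ∩ G).card + 1 = d) : G ≠ F ∧ ∃ i ∈ F, F.erase i ⊆ G := by
  have hcard := hM.card F hF
  constructor
  · rintro rfl
    rw [Finset.inter_self] at hFG
    omega
  · obtain ⟨i, hi, hiF⟩ := Finset.exists_eq_insert_iff.2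
      ⟨Finset.inter_subset_left (s₁ := F) (s₂ := G), by rw [hFG, hcard]⟩
    refine ⟨i, hiF ▸ Finset.mem_insert_self _ _, ?_⟩
    rw [← hiF, Finset.erase_insert hi]
    exact Finset.inter_subset_right

theorem card_inter_neighbor (hM : IsPseudomanifold d V 𝓕) {F N : Finset ℕ} (hF : F ∈ 𝓕)
    (hN : N ∈ 𝓕) (hNF : N ≠ F) {i : ℕ} (hi : i ∈ F) (hsub : F.erase i ⊆ N) :
    (F ∩ N).card + 1 = d := by
  have hiN := hM.notMem_of_erase_subset hF hN hNF hsub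
  have : F ∩ N = F.erase i := by
    ext j
    simp only [Finset.mem_inter, Finset.mem_erase]
    refine ⟨fun hj => ⟨?_, hj.1⟩, fun hj => ⟨hj.2, hsub (Finset.mem_erase.2 hj)⟩⟩
    rintro rfl
    exact hiN hj.2
  rw [this, Finset.card_erase_of_mem hi, hM.card F hF]
  have := Finset.card_pos.2 ⟨i, hi⟩
  rw [hM.card F hF] at this
  omega

end IsPseudomanifold

namespace Scribes

variable {d : ℕ} {K : Set (E d)} {out : Finset ℕ → Prop} {x : ℕ → E d}
  {v : Finset ℕ → E d} {V : Finset ℕ} {𝓕 : Finset (Finset ℕ)}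

/-- The points at which the edges at the vertex `v F` are cut. -/
theorem exists_cut (hK : IsClosed K) (hKc : StrictConvex ℝ K) (hS : Scribes K out x v V 𝓕)
    (hM : IsPseudomanifold d V 𝓕) {F : Finset ℕ} (hF : F ∈ 𝓕) (hout : out F)
    {N : ℕ → Finset ℕ} (hN : ∀ i ∈ F, N i ∈ 𝓕 ∧ N i ≠ F ∧ F.erase i ⊆ N i ∧ i ∉ N i)
    (out' : ℕ → Prop) :
    ∃ t : ℕ → ℝ, (∀ i ∈ F, 0 < t i ∧ t i < 1 ∧
      (out' i → AffineMap.lineMap (v F) (v (N i)) (t i) ∉ K) ∧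
      (¬ out' i → AffineMap.lineMap (v F) (v (N i)) (t i) ∈ _root_.frontier K) ∧
      (∀ r ∈ Set.Icc (0 : ℝ) 1, AffineMap.lineMap (v F) (v (N i)) r ∈ K → t i ≤ r) ∧
      ∃ r ∈ Set.Icc (t i) 1, AffineMap.lineMap (v F) (v (N i)) r ∈ interior K) ∧
      ∀ i ∈ F, ∀ j ∈ F, i ≠ j → AffineMap.lineMap (AffineMap.lineMap (v F) (v (N i)) (t i))
        (AffineMap.lineMap (v F) (v (N j)) (t j)) (1 / 2 : ℝ) ∈ interior K := by
  classical
  have hR := hS.realizes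
  have hex : ∀ i ∈ F, ∃ t s : ℝ, s ≤ 1 ∧ AffineMap.lineMap (v F) (v (N i)) s ∈ interior K ∧
      0 < t ∧ t < s ∧ AffineMap.lineMap (v F) (v (N i)) t ∈ _root_.frontier K ∧
      ∀ r ∈ Set.Icc (0 : ℝ) 1, AffineMap.lineMap (v F) (v (N i)) r ∈ K → t ≤ r := by
    intro i hi
    obtain ⟨hN1, hN2, hN3, -⟩ := hN i hi
    obtain ⟨s, hs, hsK⟩ := hS.edge F hF (N i) hN1 (hM.card_inter_neighbor hF hN1 hN2 hi hN3)
    obtain ⟨t, ht⟩ := exists_exit hK (hS.outside F hF hout) hs hsK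
    exact ⟨t, s, hs.2, hsK, ht⟩
  choose! t s hs1 hsK ht0 hts htK hmin using hex
  -- Cuts that must lie outside `K` are moved from the entry point towards `v F` by the factor `1 -
  -- ε`; the others stay on the boundary.
  let τ : ℝ → ℕ → ℝ := fun ε i => t i * (1 - if out' i then ε else 0)
  let w : ℝ → ℕ → E d := fun ε i => AffineMap.lineMap (v F) (v (N i)) (τ ε i)
  have hτ0 : ∀ i, τ 0 i = t i := fun i => by simp [τ]
  have hcont : ∀ i, Continuous fun ε => w ε i := by
    intro i
    refine AffineMap.lineMap_continuous.comp ?_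
    simp only [τ]
    split_ifs <;> fun_prop
  -- Distinct entry points are needed for strict convexity. They are told apart by `x i`, whose
  -- inequality for the normal `w 0 i` is strict and for `w 0 j` tight.
  have hdist : ∀ i ∈ F, ∀ j ∈ F, i ≠ j → w 0 i ≠ w 0 j := by
    intro i hi j hj hij heq
    have h1 : oneSub (w 0 i) (x i) = t i * oneSub (v (N i)) (x i) := by
      simp only [w, hτ0]
      rw [oneSub_lineMap_apply, hR.zero F hF i hi]
      ring
    have h2 : oneSub (w 0 j) (x i) = 0 := by
      simp only [w, hτ0]
      rw [oneSub_lineMap_apply, hR.zero F hF i hi, hR.zero (N j) (hN j hj).1 i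
        ((hN j hj).2.2.1 (Finset.mem_erase.2 ⟨hij, hi⟩))]
      ring
    rw [heq, h2] at h1
    exact (mul_pos (ht0 i hi) (hR.pos (N i) (hN i hi).1 i (hM.subset F hF hi)
      (hN i hi).2.2.2)).ne h1
  have hev : ∀ᶠ ε : ℝ in nhdsWithin 0 (Set.Ioi 0), ∀ i ∈ F, ∀ j ∈ F, i ≠ j →
      AffineMap.lineMap (w ε i) (w ε j) (1 / 2 : ℝ) ∈ interior K := by
    rw [Filter.eventually_all_finset]
    intro i hi
    rw [Filter.eventually_all_finset]
    intro j hj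
    by_cases hij : i = j
    · exact Filter.Eventually.of_forall fun _ h => absurd hij h
    have h0 : AffineMap.lineMap (w 0 i) (w 0 j) (1 / 2 : ℝ) ∈ interior K := by
      rw [AffineMap.lineMap_apply_module]
      refine hKc ?_ ?_ (hdist i hi j hj hij) (by norm_num) (by norm_num) (by norm_num)
      · simp only [w, hτ0]
        exact hK.frontier_subset (htK i hi)
      · simp only [w, hτ0]
        exact hK.frontier_subset (htK j hj)
    have hc : Continuous fun ε => (AffineMap.lineMap (w ε i) (w ε j) (1 / 2 : ℝ) : E d) := by
      simp only [AffineMap.lineMap_apply_module]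
      have := hcont i
      have := hcont j
      fun_prop
    have := (isOpen_interior.preimage hc).mem_nhds (show (0 : ℝ) ∈ _ from h0)
    exact Filter.Eventually.filter_mono nhdsWithin_le_nhds
      (Filter.Eventually.mono this fun ε hε _ => hε)
  have h01 : ∀ᶠ ε : ℝ in nhdsWithin 0 (Set.Ioi 0), ε ∈ Set.Ioo (0 : ℝ) 1 :=
    Ioo_mem_nhdsGT one_pos
  obtain ⟨ε, hε, hε0, hε1⟩ := (hev.and h01).exists
  have hle : ∀ i ∈ F, τ ε i ≤ t i := by
    intro i hi
    have := ht0 i hi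
    simp only [τ]
    split_ifs
    · nlinarith
    · simp
  refine ⟨τ ε, fun i hi => ⟨?_, (hle i hi).trans_lt ((hts i hi).trans_le (hs1 i hi)), ?_, ?_,
    fun r hr hrK => (hle i hi).trans (hmin i hi r hr hrK),
    s i, ⟨(hle i hi).trans (hts i hi).le, hs1 i hi⟩, hsK i hi⟩, hε⟩
  · have := ht0 i hi
    simp only [τ]
    split_ifs
    · exact mul_pos this (by linarith)
    · simpa
  · intro ho hmem
    have h1 := ht0 i hi
    have h2 := hts i hi
    have h3 := hs1 i hi
    have hτ : τ ε i = t i * (1 - ε) := by simp [τ, ho]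
    have := hmin i hi (τ ε i) ⟨by rw [hτ]; exact mul_nonneg h1.le (by linarith),
      by linarith [hle i hi]⟩ hmem
    rw [hτ] at this
    nlinarith
  · intro ho
    have hτ : τ ε i = t i := by simp [τ, ho]
    rw [hτ]
    exact htK i hi

/-- The apex of the pyramid with the given facet normals. -/
theorem exists_apex (hd : 1 ≤ d) (hS : Scribes K out x v V 𝓕)
    (hM : IsPseudomanifold d V 𝓕) {F : Finset ℕ} (hF : F ∈ 𝓕)
    {N : ℕ → Finset ℕ} (hN : ∀ i ∈ F, N i ∈ 𝓕 ∧ N i ≠ F ∧ F.erase i ⊆ N i ∧ i ∉ N i)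
    (huniq : ∀ i ∈ F, ∀ N' ∈ 𝓕, N' ≠ F → F.erase i ⊆ N' → N' = N i)
    {t : ℕ → ℝ} (ht0 : ∀ i ∈ F, 0 < t i) (ht1 : ∀ i ∈ F, t i < 1)
    (ht : ∀ i ∈ F, ∀ r ∈ Set.Icc (0 : ℝ) 1,
      AffineMap.lineMap (v F) (v (N i)) r ∈ K → t i ≤ r) :
    ∃ p : E d, oneSub (v F) p < 0 ∧ (∀ G ∈ 𝓕, G ≠ F → 0 < oneSub (v G) p) ∧
      ∀ i ∈ F, oneSub (AffineMap.lineMap (v F) (v (N i)) (t i)) p = 0 := by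
  have hR := hS.realizes
  have hFV := hM.subset F hF
  let δ : ℕ → ℝ := fun i => oneSub (v (N i)) (x i)
  have hδ : ∀ i ∈ F, 0 < δ i := fun i hi =>
    hR.pos (N i) (hN i hi).1 i (hFV hi) (hN i hi).2.2.2
  have htδ : ∀ i ∈ F, 0 < t i * δ i := fun i hi => mul_pos (ht0 i hi) (hδ i hi)
  -- The weights are chosen so that the affine function `σ` is `0` at `v F` and `1` at every cut
  -- point. The cutting hyperplane is thus `σ = 1`, that is, `⟪u, q⟫ = c - 1`, and it is polar to
  -- `(c - 1)⁻¹ • q`.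
  let q : E d := ∑ i ∈ F, (t i * δ i)⁻¹ • x i
  let c : ℝ := ∑ i ∈ F, (t i * δ i)⁻¹
  let σ : E d → ℝ := fun u => ∑ i ∈ F, (t i * δ i)⁻¹ * oneSub u (x i)
  have hq : ∀ u, inner ℝ u q = c - σ u := by
    intro u
    simp only [q, c, σ, oneSub_apply, inner_sum, inner_smul_right, ← Finset.sum_sub_distrib]
    refine Finset.sum_congr rfl fun i _ => ?_
    ring
  have hσF : σ (v F) = 0 := Finset.sum_eq_zero fun i hi => by
    rw [hR.zero F hF i hi, mul_zero]
  have hσw : ∀ i ∈ F, σ (AffineMap.lineMap (v F) (v (N i)) (t i)) = 1 := by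
    intro i hi
    simp only [σ]
    rw [Finset.sum_eq_single i]
    · rw [oneSub_lineMap_apply, hR.zero F hF i hi, mul_zero, zero_add]
      exact inv_mul_cancel₀ (htδ i hi).ne'
    · intro j hj hji
      rw [oneSub_lineMap_apply, hR.zero F hF j hj, hR.zero (N i) (hN i hi).1 j
        ((hN i hi).2.2.1 (Finset.mem_erase.2 ⟨hji, hj⟩))]
      ring
    · exact fun h => absurd hi h
  have hσG : ∀ G ∈ 𝓕, G ≠ F → 1 < σ (v G) := by
    intro G hG hGF
    obtain ⟨k, hkG, hkF⟩ : ∃ k ∈ G, k ∉ F := by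
      by_contra! hcon
      exact hGF (hM.eq_of_subset hG hF hcon)
    -- With `o = 0` the expansion says that `v G - v F` is the combination of the edge vectors `v (N
    -- i) - v F` with coefficients `β i ≥ 0`. Evaluating at a vertex of `G` outside `F` gives `∑ β i
    -- ≥ 1`; as `σ (v (N i)) = (t i)⁻¹ > 1`, it follows that `σ (v G) = ∑ (t i)⁻¹ * β i > 1`.
    have h0 : oneSub (v F) 0 = 1 := by simp
    have hexp := Realizes.expansion hM hR hF hN (o := 0) (by rw [h0]; exact one_ne_zero)
      (oneSub (v G)) (x k)
    have hkV := hM.subset G hG hkG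
    have hkpos := hR.pos F hF k hkV hkF
    let β : ℕ → ℝ := fun i => (δ i)⁻¹ * oneSub (v G) (x i)
    have hβ : ∀ i ∈ F, 0 ≤ β i := fun i hi =>
      mul_nonneg (inv_nonneg.2 (hδ i hi).le) (hR.nonneg hG (hFV hi))
    have hexp' : oneSub (v F) (x k) * (∑ i ∈ F, β i - 1) =
        ∑ i ∈ F, β i * oneSub (v (N i)) (x k) := by
      rw [hR.zero G hG k hkG] at hexp
      have h1 : ∀ u : E d, oneSub u 0 = 1 := fun u => by simp
      simp only [h1, div_one, mul_one] at hexp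
      have hsum : ∑ i ∈ F, (oneSub (v (N i)) (x k) - 1 * oneSub (v F) (x k)) /
          oneSub (v (N i)) (x i) * oneSub (v G) (x i) =
          ∑ i ∈ F, β i * oneSub (v (N i)) (x k) - oneSub (v F) (x k) * ∑ i ∈ F, β i := by
        rw [Finset.mul_sum, ← Finset.sum_sub_distrib]
        refine Finset.sum_congr rfl fun i _ => ?_
        simp only [β, δ]
        ring
      rw [hsum] at hexp
      linarith
    have hnn : 0 ≤ ∑ i ∈ F, β i * oneSub (v (N i)) (x k) :=
      Finset.sum_nonneg fun i hi => mul_nonneg (hβ i hi) (hR.nonneg (hN i hi).1 hkV)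
    have hβ1 : 1 ≤ ∑ i ∈ F, β i := by
      rw [← hexp'] at hnn
      linarith [nonneg_of_mul_nonneg_right hnn hkpos]
    refine hβ1.trans_lt ?_
    obtain ⟨j, hj, hjβ⟩ : ∃ j ∈ F, β j ≠ 0 := by
      by_contra! hcon
      rw [Finset.sum_eq_zero hcon] at hβ1
      linarith
    have hterm : ∀ i ∈ F, (t i * δ i)⁻¹ * oneSub (v G) (x i) = (t i)⁻¹ * β i := by
      intro i _
      rw [mul_inv]
      simp only [β]
      ring
    refine Finset.sum_lt_sum (fun i hi => ?_) ⟨j, hj, ?_⟩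
    · rw [hterm i hi]
      exact le_mul_of_one_le_left (hβ i hi) ((one_le_inv₀ (ht0 i hi)).2 (ht1 i hi).le)
    · rw [hterm j hj]
      exact lt_mul_of_one_lt_left (lt_of_le_of_ne (hβ j hj) hjβ.symm)
        ((one_lt_inv₀ (ht0 j hj)).2 (ht1 j hj))
  have hc0 : 0 < c := Finset.sum_pos (fun i hi => inv_pos.2 (htδ i hi)) (hM.facet_nonempty hd hF)
  -- Since `σ 0 = c`, this says that the origin is not cut off. Otherwise `⟪·, q⟫ = c - σ` would be
  -- nonpositive on every edge point in `K`: on edges at `v F` such points come after the cut, so `σ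
  -- ≥ 1` there, and other edges lie in `σ > 1`. This contradicts `core` for `z = q`.
  have hc : 1 < c := by
    by_contra! hc1
    have hq0 : q ≠ 0 := by
      intro h0
      have := hq (v F)
      rw [h0, inner_zero_right, hσF] at this
      linarith
    have hneg : ∀ G ∈ 𝓕, G ≠ F → inner ℝ (v G) q < 0 := by
      intro G hG hGF
      rw [hq]
      linarith [hσG G hG hGF]
    have hcut : ∀ G ∈ 𝓕, (F ∩ G).card + 1 = d → ∀ r ∈ Set.Icc (0 : ℝ) 1,
        AffineMap.lineMap (v F) (v G) r ∈ K →
        inner ℝ q (AffineMap.lineMap (v F) (v G) r) ≤ 0 := by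
      intro G hG hFG r hr hrK
      obtain ⟨hGF, i, hi, hsub⟩ := hM.exists_erase_subset hF hFG
      obtain rfl := huniq i hi G hG hGF hsub
      have hir := ht i hi r hr hrK
      have h1 := hσw i hi
      have h2 := hq (AffineMap.lineMap (v F) (v (N i)) (t i))
      have h3 := hneg _ hG hGF
      rw [h1] at h2
      rw [real_inner_comm]
      rw [AffineMap.lineMap_apply_module, inner_add_left, inner_smul_left, inner_smul_left] at h2 ⊢
      simp only [RCLike.conj_to_real] at h2 ⊢
      have h4 : 0 < inner ℝ (v F) q := by
        rw [hq, hσF]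
        linarith
      nlinarith
    obtain ⟨G, hG, G', hG', hGG', r, hr, hrK, hpos⟩ := hS.core q hq0
    by_cases hGF : G = F
    · subst hGF
      exact absurd hpos (not_lt.2 (hcut G' hG' hGG' r hr hrK))
    by_cases hG'F : G' = F
    · subst hG'F
      rw [← AffineMap.lineMap_apply_one_sub] at hrK hpos
      refine absurd hpos (not_lt.2 (hcut G hG (by rwa [Finset.inter_comm]) (1 - r)
        ⟨by linarith [hr.2], by linarith [hr.1]⟩ hrK))
    · have h1 := hneg G hG hGF
      have h2 := hneg G' hG' hG'F
      rw [real_inner_comm, AffineMap.lineMap_apply_module, inner_add_left, inner_smul_left,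
        inner_smul_left] at hpos
      simp only [RCLike.conj_to_real] at hpos
      have := hr.1
      have := hr.2
      nlinarith
  have hcc : 0 < c - 1 := by linarith
  have hp : ∀ u, oneSub u ((c - 1)⁻¹ • q) = (c - 1)⁻¹ * (σ u - 1) := by
    intro u
    rw [oneSub_apply, inner_smul_right, hq]
    field_simp
    ring
  refine ⟨(c - 1)⁻¹ • q, ?_, fun G hG hGF => ?_, fun i hi => ?_⟩
  · rw [hp, hσF]
    exact mul_neg_of_pos_of_neg (inv_pos.2 hcc) (by norm_num)
  · rw [hp]
    exact mul_pos (inv_pos.2 hcc) (by linarith [hσG G hG hGF])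
  · rw [hp, hσw i hi]
    ring

/-- The vertex `v F` outside of `K` can be truncated. -/
theorem stack (hd : 1 ≤ d) (hK : IsClosed K) (hKc : StrictConvex ℝ K) {F : Finset ℕ} {n : ℕ}
    {out' : Finset ℕ → Prop}
    (hS : Scribes K (fun G => G = F ∨ out' G) x v V 𝓕) (hM : IsPseudomanifold d V 𝓕)
    (hF : F ∈ 𝓕) (hn : n ∉ V) :
    ∃ x' v', Scribes K out' x' v' (insert n V) (stackFacets 𝓕 F n) := by
  have hnF := hM.notMem hF hn
  obtain ⟨N, hN, huniq⟩ := hM.exists_neighbors hF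
  obtain ⟨t, ht, hmid⟩ := exists_cut hK hKc hS hM hF (Or.inl rfl) hN
    fun i => out' (insert n (F.erase i))
  obtain ⟨p, hpF, hpG, hpw⟩ := exists_apex hd hS hM hF hN huniq (fun i hi => (ht i hi).1)
    (fun i hi => (ht i hi).2.1) fun i hi => (ht i hi).2.2.2.2.1
  obtain ⟨v', hold, hnew⟩ := exists_extend_to_stackFacets F hnF v
    fun i => AffineMap.lineMap (v F) (v (N i)) (t i)
  have hold' : ∀ G ∈ 𝓕, v' G = v G := fun G hG => hold G (hM.notMem hG hn)
  -- the edge at a new vertex that is a part of an old edge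
  have hedge : ∀ i ∈ F, ∀ r ∈ Set.Icc (t i) 1, ∃ s ∈ Set.Icc (0 : ℝ) 1,
      (AffineMap.lineMap (v F) (v (N i)) r : E d) =
        AffineMap.lineMap (v' (insert n (F.erase i))) (v' (N i)) s := by
    intro i hi r hr
    obtain ⟨-, h1, -⟩ := ht i hi
    have h2 : 0 < 1 - t i := by linarith
    -- Affine reparametrization sending `t i` to `0` and fixing `1`.
    refine ⟨(r - t i) / (1 - t i), ⟨div_nonneg (by linarith [hr.1]) h2.le,
      (div_le_one h2).2 (by linarith [hr.2])⟩, ?_⟩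
    rw [hnew i hi, hold' _ (hN i hi).1]
    simp only [AffineMap.lineMap_apply_module', smul_sub, smul_add]
    match_scalars <;> field_simp <;> ring
  have hcardN : ∀ i ∈ F, (insert n (F.erase i) ∩ N i).card + 1 = d := by
    intro i hi
    obtain ⟨h1, h2, h3, h4⟩ := hN i hi
    have hnN := hM.notMem h1 hn
    rw [← hM.card_inter_neighbor hF h1 h2 hi h3, Finset.insert_inter_of_notMem hnN]
    congr 2
    ext j
    simp only [Finset.mem_inter, Finset.mem_erase]
    constructor
    · tauto
    · rintro ⟨hjF, hjN⟩
      refine ⟨⟨?_, hjF⟩, hjN⟩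
      rintro rfl
      exact h4 hjN
  have hmemN : ∀ i ∈ F, N i ∈ stackFacets 𝓕 F n := fun i hi =>
    mem_stackFacets.2 (Or.inl ⟨(hN i hi).1, (hN i hi).2.1⟩)
  have hmemn : ∀ i ∈ F, insert n (F.erase i) ∈ stackFacets 𝓕 F n := fun i hi =>
    mem_stackFacets.2 (Or.inr ⟨i, hi, rfl⟩)
  -- a new facet and an old one that are adjacent
  have hnewold : ∀ i ∈ F, ∀ G ∈ 𝓕, G ≠ F → (insert n (F.erase i) ∩ G).card + 1 = d →
      G = N i := by
    intro i hi G hG hGF hcard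
    have hnG := hM.notMem hG hn
    refine huniq i hi G hG hGF ?_
    rw [Finset.insert_inter_of_notMem hnG] at hcard
    have hle : (F.erase i).card ≤ (F.erase i ∩ G).card := by
      rw [Finset.card_erase_of_mem hi, hM.card F hF]
      omega
    have := Finset.eq_of_subset_of_card_le (Finset.inter_subset_left) hle
    exact Finset.inter_eq_left.1 this
  refine ⟨Function.update x n p, v', ⟨?_, ?_, ?_, ?_, ?_⟩⟩
  · refine hS.realizes.stack hM hF hn hpF hpG (fun G hG _ => by rw [hold' G hG]) ?_ ?_
    · intro i hi N' hN' hN'F hsub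
      obtain rfl := huniq i hi N' hN' hN'F hsub
      obtain ⟨h0, h1, -⟩ := ht i hi
      refine ⟨1 - t i, t i, by linarith, h0, ?_⟩
      rw [hnew i hi, oneSub_lineMap]
    · intro i hi
      rw [hnew i hi]
      exact hpw i hi
  · intro G hG hGo
    rcases mem_stackFacets.1 hG with ⟨hG, hGF⟩ | ⟨i, hi, rfl⟩
    · rw [hold' G hG]
      exact hS.outside G hG (Or.inr hGo)
    · rw [hnew i hi]
      exact (ht i hi).2.2.1 hGo
  · intro G hG hGo
    rcases mem_stackFacets.1 hG with ⟨hG, hGF⟩ | ⟨i, hi, rfl⟩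
    · rw [hold' G hG]
      exact hS.frontier G hG (not_or.2 ⟨hGF, hGo⟩)
    · rw [hnew i hi]
      exact (ht i hi).2.2.2.1 hGo
  · have hno : ∀ i ∈ F, ∀ G ∈ 𝓕, G ≠ F → (insert n (F.erase i) ∩ G).card + 1 = d →
        ∃ s ∈ Set.Icc (0 : ℝ) 1,
          AffineMap.lineMap (v' (insert n (F.erase i))) (v' G) s ∈ interior K := by
      intro i hi G hG hGF hcard
      obtain rfl := hnewold i hi G hG hGF hcard
      obtain ⟨-, -, -, -, -, r, hr, hrK⟩ := ht i hi
      obtain ⟨s, hs, heq⟩ := hedge i hi r hr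
      exact ⟨s, hs, heq ▸ hrK⟩
    intro G hG G' hG' hcard
    rcases mem_stackFacets.1 hG with ⟨hG, hGF⟩ | ⟨i, hi, rfl⟩ <;>
      rcases mem_stackFacets.1 hG' with ⟨hG', hG'F⟩ | ⟨j, hj, rfl⟩
    · rw [hold' G hG, hold' G' hG']
      exact hS.edge G hG G' hG' hcard
    · obtain ⟨s, hs, hsK⟩ := hno j hj G hG hGF (by rwa [Finset.inter_comm])
      exact ⟨1 - s, ⟨by linarith [hs.2], by linarith [hs.1]⟩, by
        rwa [AffineMap.lineMap_apply_one_sub]⟩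
    · exact hno i hi G' hG' hG'F hcard
    · have hij : i ≠ j := by
        rintro rfl
        have := (hM.stack hd hF hn).card _ (hmemn i hi)
        rw [Finset.inter_self] at hcard
        omega
      rw [hnew i hi, hnew j hj]
      exact ⟨1 / 2, ⟨by norm_num, by norm_num⟩, hmid i hi j hj hij⟩
  · intro z hz
    -- A witness on an edge at the removed vertex survives: it lies in `K`, hence beyond the cut, on
    -- the shortened edge.
    have hFG : ∀ G ∈ 𝓕, (F ∩ G).card + 1 = d → ∀ r ∈ Set.Icc (0 : ℝ) 1,
        AffineMap.lineMap (v F) (v G) r ∈ K →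
        0 < inner ℝ z (AffineMap.lineMap (v F) (v G) r) →
        ∃ F₁ ∈ stackFacets 𝓕 F n, ∃ G₁ ∈ stackFacets 𝓕 F n, (F₁ ∩ G₁).card + 1 = d ∧
          ∃ t ∈ Set.Icc (0 : ℝ) 1, AffineMap.lineMap (v' F₁) (v' G₁) t ∈ K ∧
            0 < inner ℝ z (AffineMap.lineMap (v' F₁) (v' G₁) t) := by
      intro G hG hcard r hr hrK hpos
      obtain ⟨hGF, i, hi, hsub⟩ := hM.exists_erase_subset hF hcard
      obtain rfl := huniq i hi G hG hGF hsub
      obtain ⟨s, hs, heq⟩ := hedge i hi r ⟨(ht i hi).2.2.2.2.1 r hr hrK, hr.2⟩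
      exact ⟨_, hmemn i hi, _, hmemN i hi, hcardN i hi, s, hs, heq ▸ hrK, heq ▸ hpos⟩
    obtain ⟨G, hG, G', hG', hcard, r, hr, hrK, hpos⟩ := hS.core z hz
    by_cases hGF : G = F
    · subst hGF
      exact hFG G' hG' hcard r hr hrK hpos
    by_cases hG'F : G' = F
    · subst hG'F
      rw [← AffineMap.lineMap_apply_one_sub] at hrK hpos
      exact hFG G hG (by rwa [Finset.inter_comm]) (1 - r)
        ⟨by linarith [hr.2], by linarith [hr.1]⟩ hrK hpos
    · refine ⟨G, mem_stackFacets.2 (Or.inl ⟨hG, hGF⟩), G', mem_stackFacets.2 (Or.inl ⟨hG', hG'F⟩),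
        hcard, r, hr, ?_⟩
      rw [hold' G hG, hold' G' hG']
      exact ⟨hrK, hpos⟩

end Scribes

/-! ### The initial simplex -/

/-- The coordinate vectors and minus their sum. -/
noncomputable def simplexNormal (d : ℕ) (k : ℕ) : E d :=
  if hk : k < d then EuclideanSpace.single ⟨k, hk⟩ 1 else -∑ j, EuclideanSpace.single j 1

theorem inner_simplexNormal_of_lt {d : ℕ} (k : Fin d) (y : E d) :
    inner ℝ (simplexNormal d k) y = y k := by
  simp [simplexNormal, EuclideanSpace.inner_single_left]

theorem inner_simplexNormal_self {d : ℕ} (y : E d) :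
    inner ℝ (simplexNormal d d) y = -∑ j, y j := by
  simp [simplexNormal, sum_inner, EuclideanSpace.inner_single_left]

theorem sum_inner_simplexNormal {d : ℕ} (y : E d) :
    ∑ k ∈ Finset.range (d + 1), inner ℝ (simplexNormal d k) y = 0 := by
  rw [Finset.sum_range_succ, inner_simplexNormal_self, Finset.sum_range]
  simp [inner_simplexNormal_of_lt]

/-- The vertices are explicit: `x i` has coordinates `(ν j)⁻¹`, with `M = ∑ (ν k)⁻¹` subtracted at
position `i`; for `i = d` nothing is subtracted. The slack at the opposite vertex is `ν k * M`. -/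
theorem exists_simplex_dual {d : ℕ} (ν : ℕ → ℝ) (hν : ∀ k ≤ d, 0 < ν k) :
    ∃ x : ℕ → E d, (∀ k ≤ d, ∀ i ≤ d, k ≠ i → oneSub (ν k • simplexNormal d k) (x i) = 0) ∧
      ∀ k ≤ d, 0 < oneSub (ν k • simplexNormal d k) (x k) := by
  let M : ℝ := ∑ k ∈ Finset.range (d + 1), (ν k)⁻¹
  have hM : 0 < M := Finset.sum_pos
    (fun k hk => inv_pos.2 (hν k (Nat.lt_succ_iff.1 (Finset.mem_range.1 hk)))) (by simp)
  let x : ℕ → E d := fun i => WithLp.toLp 2 fun j : Fin d => (ν j)⁻¹ - if j.1 = i then M else 0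
  have hx : ∀ i (j : Fin d), x i j = (ν j)⁻¹ - if j.1 = i then M else 0 := fun i j => rfl
  have key : ∀ k ≤ d, ∀ i ≤ d, oneSub (ν k • simplexNormal d k) (x i) =
      if k = i then ν k * M else 0 := by
    intro k hk i hi
    have hνk := hν k hk
    rw [oneSub_apply, inner_smul_left, RCLike.conj_to_real]
    rcases hk.lt_or_eq with hk | rfl
    · have := inner_simplexNormal_of_lt ⟨k, hk⟩ (x i)
      simp only at this
      rw [this, hx]
      simp only
      split_ifs <;> field_simp <;> ring
    · rw [inner_simplexNormal_self]
      simp_rw [hx, Finset.sum_sub_distrib]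
      have hMk : ∑ j : Fin k, (ν j)⁻¹ = M - (ν k)⁻¹ := by
        simp only [M]
        rw [Finset.sum_range_succ, Finset.sum_range]
        ring
      rw [hMk]
      rcases hi.lt_or_eq with hi | rfl
      · have : ∑ j : Fin k, (if j.1 = i then M else 0) = M := by
          rw [Finset.sum_eq_single ⟨i, hi⟩]
          · simp
          · intro j _ hj
            rw [if_neg fun he => hj (Fin.ext he)]
          · simp
        rw [this, if_neg hi.ne']
        field_simp
        ring
      · have : ∑ j : Fin i, (if j.1 = i then M else 0) = 0 :=
          Finset.sum_eq_zero fun j _ => if_neg j.2.ne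
        rw [this, if_pos rfl]
        field_simp
        ring
  refine ⟨x, fun k hk i hi hki => ?_, fun k hk => ?_⟩
  · rw [key k hk i hi, if_neg hki]
  · rw [key k hk k hk, if_pos rfl]
    exact mul_pos (hν k hk) hM

theorem simplexNormal_ne_zero {d : ℕ} (hd : 1 ≤ d) (k : ℕ) (hk : k ≤ d) :
    simplexNormal d k ≠ 0 := by
  intro h0
  obtain ⟨x, hx, -⟩ := exists_simplex_dual (d := d) (fun _ => 1) (fun _ _ => one_pos)
  have := hx k hk (if k = 0 then 1 else 0) (by split_ifs <;> omega) (by split_ifs <;> omega)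
  simp [h0] at this

/-- The normals are positive multiples of `d + 1` vectors with sum zero, scaled by the gauge to
reach the boundary of `K` and stretched slightly when they must lie outside. -/
theorem exists_scribes_simplex {d : ℕ} (hd : 1 ≤ d) {K : Set (E d)} (hK : IsCompact K)
    (hKc : StrictConvex ℝ K) (h0 : 0 ∈ interior K) (out : Finset ℕ → Prop) :
    ∃ x v, Scribes K out x v (Finset.range (d + 1))
      ((Finset.range (d + 1)).image fun i => (Finset.range (d + 1)).erase i) := by
  classical
  have hconv := hKc.convex
  have hnhds : K ∈ nhds (0 : E d) := mem_interior_iff_mem_nhds.1 h0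
  have habs : Absorbent ℝ K := absorbent_nhds_zero hnhds
  let a := simplexNormal d
  have hgpos : ∀ k ≤ d, 0 < gauge K (a k) := fun k hk =>
    (gauge_pos habs (NormedSpace.isVonNBounded_of_isBounded _ hK.isBounded)).2
      (simplexNormal_ne_zero hd k hk)
  let μ : ℕ → ℝ := fun k => (gauge K (a k))⁻¹
  have hμ : ∀ k ≤ d, 0 < μ k := fun k hk => inv_pos.2 (hgpos k hk)
  have hgauge : ∀ k ≤ d, ∀ c : ℝ, 0 ≤ c → gauge K ((μ k * c) • a k) = c := by
    intro k hk c hc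
    rw [gauge_smul_of_nonneg (mul_nonneg (hμ k hk).le hc), smul_eq_mul]
    have := (hgpos k hk).ne'
    simp only [μ]
    field_simp
  have hfront : ∀ k ≤ d, μ k • a k ∈ frontier K := by
    intro k hk
    rw [← gauge_eq_one_iff_mem_frontier hconv hnhds]
    simpa using hgauge k hk 1 zero_le_one
  -- One parameter `s` serves for both `edge` and `core`: it is so close to the first endpoint that
  -- the second cannot spoil a positive inner product. It is fixed before `ε`, and the factor `2`
  -- absorbs the later stretching by `1 + ε < 2`.
  obtain ⟨s, ⟨hs0, hs1⟩, hs⟩ : ∃ s ∈ Set.Ioo (0 : ℝ) 1,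
      ∀ k ∈ Finset.range (d + 1), ∀ l ∈ Finset.range (d + 1),
        0 < (1 - s) * μ k - s * (2 * μ l) * d := by
    have hev : ∀ᶠ s : ℝ in nhdsWithin 0 (Set.Ioi 0), ∀ k ∈ Finset.range (d + 1),
        ∀ l ∈ Finset.range (d + 1), 0 < (1 - s) * μ k - s * (2 * μ l) * d := by
      rw [Filter.eventually_all_finset]
      intro k hk
      rw [Filter.eventually_all_finset]
      intro l _
      refine Filter.Eventually.filter_mono nhdsWithin_le_nhds ?_
      have hc : Continuous fun s : ℝ => (1 - s) * μ k - s * (2 * μ l) * d := by fun_prop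
      refine hc.continuousAt.eventually (lt_mem_nhds ?_)
      simpa using hμ k (Nat.lt_succ_iff.1 (Finset.mem_range.1 hk))
    obtain ⟨s, h1, h2⟩ := (hev.and (Ioo_mem_nhdsGT one_pos)).exists
    exact ⟨s, h2, h1⟩
  let o : ℕ → Prop := fun k => out ((Finset.range (d + 1)).erase k)
  let ν : ℝ → ℕ → ℝ := fun ε k => μ k * (1 + if o k then ε else 0)
  have hν0 : ∀ k, ν 0 k = μ k := fun k => by simp [ν]
  obtain ⟨ε, ⟨hε0, hε1⟩, hε⟩ : ∃ ε ∈ Set.Ioo (0 : ℝ) 1,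
      ∀ k ∈ Finset.range (d + 1), ∀ l ∈ Finset.range (d + 1), k ≠ l →
        AffineMap.lineMap (ν ε k • a k) (ν ε l • a l) s ∈ interior K := by
    have hev : ∀ᶠ ε : ℝ in nhdsWithin 0 (Set.Ioi 0), ∀ k ∈ Finset.range (d + 1),
        ∀ l ∈ Finset.range (d + 1), k ≠ l →
          AffineMap.lineMap (ν ε k • a k) (ν ε l • a l) s ∈ interior K := by
      rw [Filter.eventually_all_finset]
      intro k hk
      rw [Filter.eventually_all_finset]
      intro l hl
      by_cases hkl : k = l
      · exact Filter.Eventually.of_forall fun _ h => absurd hkl h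
      have hk' : k ≤ d := Nat.lt_succ_iff.1 (Finset.mem_range.1 hk)
      have hl' : l ≤ d := Nat.lt_succ_iff.1 (Finset.mem_range.1 hl)
      have hne : μ k • a k ≠ μ l • a l := by
        intro he
        obtain ⟨x, hx, hx'⟩ := exists_simplex_dual μ hμ
        have h1 := hx' k hk'
        have h2 := hx l hl' k hk' (Ne.symm hkl)
        simp only [a] at he
        rw [he, h2] at h1
        exact lt_irrefl _ h1
      have hint : AffineMap.lineMap (ν 0 k • a k) (ν 0 l • a l) s ∈ interior K := by
        rw [hν0, hν0, AffineMap.lineMap_apply_module]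
        exact hKc (hK.isClosed.frontier_subset (hfront k hk'))
          (hK.isClosed.frontier_subset (hfront l hl')) hne (by linarith) hs0 (by ring)
      have hνc : ∀ k, Continuous fun ε => ν ε k := by
        intro k
        simp only [ν]
        split_ifs <;> fun_prop
      have hc : Continuous fun ε =>
          (AffineMap.lineMap (ν ε k • a k) (ν ε l • a l) s : E d) := by
        simp only [AffineMap.lineMap_apply_module]
        have := hνc k
        have := hνc l
        fun_prop
      have := (isOpen_interior.preimage hc).mem_nhds (show (0 : ℝ) ∈ _ from hint)
      exact Filter.Eventually.filter_mono nhdsWithin_le_nhds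
        (Filter.Eventually.mono this fun ε hε _ => hε)
    obtain ⟨ε, h1, h2⟩ := (hev.and (Ioo_mem_nhdsGT one_pos)).exists
    exact ⟨ε, h2, h1⟩
  have hν1 : ∀ k ≤ d, μ k ≤ ν ε k ∧ ν ε k ≤ 2 * μ k := by
    intro k hk
    have := hμ k hk
    simp only [ν]
    constructor <;> split_ifs <;> nlinarith
  obtain ⟨x, hx, hx'⟩ := exists_simplex_dual (ν ε) fun k hk => (hμ k hk).trans_le (hν1 k hk).1
  -- On a facet of the simplex the sum has a single term, that of the missing vertex.
  let v : Finset ℕ → E d := fun F => ∑ k ∈ Finset.range (d + 1) \ F, ν ε k • a k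
  have hv : ∀ k ∈ Finset.range (d + 1), v ((Finset.range (d + 1)).erase k) = ν ε k • a k := by
    intro k hk
    simp only [v]
    rw [Finset.sdiff_erase_self hk, Finset.sum_singleton]
  have hcard : ∀ k ∈ Finset.range (d + 1), ∀ l ∈ Finset.range (d + 1), k ≠ l →
      ((Finset.range (d + 1)).erase k ∩ (Finset.range (d + 1)).erase l).card + 1 = d := by
    intro k hk l hl hkl
    refine (IsPseudomanifold.simplex (d := d)).card_inter_neighbor (Finset.mem_image_of_mem _ hk)
      (Finset.mem_image_of_mem _ hl) ?_ (i := l) (Finset.mem_erase.2 ⟨hkl.symm, hl⟩) ?_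
    · intro he
      have := Finset.mem_erase.2 ⟨hkl, hk⟩
      rw [he] at this
      simp at this
    · exact fun j hj => Finset.mem_erase.2
        ⟨(Finset.mem_erase.1 hj).1, Finset.mem_of_mem_erase (Finset.mem_of_mem_erase hj)⟩
  refine ⟨x, v, ⟨Realizes.simplex ?_ ?_, ?_, ?_, ?_, ?_⟩⟩
  · intro i hi j hj hij
    rw [hv i (Finset.mem_range.2 (by omega))]
    exact hx i hi j hj hij
  · intro i hi
    rw [hv i (Finset.mem_range.2 (by omega))]
    exact hx' i hi
  · intro F hF ho
    obtain ⟨k, hk, rfl⟩ := Finset.mem_image.1 hF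
    have ho' : o k := ho
    rw [hv k hk]
    intro hmem
    have h1 := gauge_le_one_of_mem hmem
    have h2 : ν ε k = μ k * (1 + ε) := by simp [ν, ho']
    rw [h2, hgauge k (Nat.lt_succ_iff.1 (Finset.mem_range.1 hk)) _ (by linarith)] at h1
    linarith
  · intro F hF ho
    obtain ⟨k, hk, rfl⟩ := Finset.mem_image.1 hF
    have ho' : ¬ o k := ho
    have h2 : ν ε k = μ k := by simp [ν, ho']
    rw [hv k hk, h2]
    exact hfront k (Nat.lt_succ_iff.1 (Finset.mem_range.1 hk))
  · intro F hF G hG hFG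
    obtain ⟨k, hk, rfl⟩ := Finset.mem_image.1 hF
    obtain ⟨l, hl, rfl⟩ := Finset.mem_image.1 hG
    have hkl : k ≠ l := by
      rintro rfl
      rw [Finset.inter_self, Finset.card_erase_of_mem hk, Finset.card_range] at hFG
      omega
    rw [hv k hk, hv l hl]
    exact ⟨s, ⟨hs0.le, hs1.le⟩, hε k hk l hl hkl⟩
  · intro z hz
    -- The values `⟪a k, z⟫` sum to zero and do not all vanish, so the largest is positive, and
    -- every other one is at least `-d` times it.
    obtain ⟨k, hk, hmax⟩ := Finset.exists_max_image (Finset.range (d + 1))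
      (fun k => inner ℝ (a k) z) (by simp)
    have hsum : ∑ k ∈ Finset.range (d + 1), inner ℝ (a k) z = 0 := sum_inner_simplexNormal z
    have hpos : 0 < inner ℝ (a k) z := by
      by_contra! hle
      have hz0 := (Finset.sum_eq_zero_iff_of_nonpos
        (fun l hl => (hmax l hl).trans hle)).1 hsum
      refine hz (PiLp.ext fun j => ?_)
      have := hz0 j (Finset.mem_range.2 (by omega))
      simp only [a] at this
      rwa [inner_simplexNormal_of_lt] at this
    obtain ⟨l, hl, hkl⟩ : ∃ l ∈ Finset.range (d + 1), k ≠ l := by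
      refine ⟨if k = 0 then 1 else 0, ?_, ?_⟩
      · rw [Finset.mem_range]
        split_ifs <;> omega
      · split_ifs <;> omega
    have hlow : -(d * inner ℝ (a k) z) ≤ inner ℝ (a l) z := by
      rw [← Finset.add_sum_erase _ _ hl] at hsum
      have := Finset.sum_le_card_nsmul ((Finset.range (d + 1)).erase l)
        (fun j => inner ℝ (a j) z) _ fun j hj => hmax j (Finset.mem_of_mem_erase hj)
      rw [Finset.card_erase_of_mem hl, Finset.card_range, Nat.add_sub_cancel, nsmul_eq_mul] at this
      linarith
    refine ⟨_, Finset.mem_image_of_mem _ hk, _, Finset.mem_image_of_mem _ hl,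
      hcard k hk l hl hkl, s, ⟨hs0.le, hs1.le⟩, ?_⟩
    rw [hv k hk, hv l hl]
    refine ⟨interior_subset (hε k hk l hl hkl), ?_⟩
    rw [AffineMap.lineMap_apply_module, inner_add_right, inner_smul_right, inner_smul_right,
      inner_smul_right, inner_smul_right, real_inner_comm, real_inner_comm (a l) z]
    have hk1 := hν1 k (Nat.lt_succ_iff.1 (Finset.mem_range.1 hk))
    have hl1 := hν1 l (Nat.lt_succ_iff.1 (Finset.mem_range.1 hl))
    have hμl := hμ l (Nat.lt_succ_iff.1 (Finset.mem_range.1 hl))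
    have h1 : (1 - s) * (μ k * inner ℝ (a k) z) ≤ (1 - s) * (ν ε k * inner ℝ (a k) z) :=
      mul_le_mul_of_nonneg_left (mul_le_mul_of_nonneg_right hk1.1 hpos.le) (by linarith)
    have h2 : ν ε l * -(d * inner ℝ (a k) z) ≤ ν ε l * inner ℝ (a l) z :=
      mul_le_mul_of_nonneg_left hlow (by linarith)
    have h3 : ν ε l * (d * inner ℝ (a k) z) ≤ 2 * μ l * (d * inner ℝ (a k) z) :=
      mul_le_mul_of_nonneg_right hl1.2 (by positivity)
    have h4 : s * (-(2 * μ l * (d * inner ℝ (a k) z))) ≤ s * (ν ε l * inner ℝ (a l) z) :=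
      mul_le_mul_of_nonneg_left (by linarith) hs0.le
    have h5 := mul_pos (hs k hk l hl) hpos
    linarith

/-- Every stacked complex has a realization whose facet normals lie on the boundary of `K`, except
for arbitrarily prescribed ones that lie outside of `K`. -/
theorem StackedComplex.exists_scribes {d : ℕ} (hd : 1 ≤ d) {K : Set (E d)} (hK : IsCompact K)
    (hKc : StrictConvex ℝ K) (h0 : 0 ∈ interior K) {V : Finset ℕ} {𝓕 : Finset (Finset ℕ)}
    (hC : StackedComplex d V 𝓕) (out : Finset ℕ → Prop) : ∃ x v, Scribes K out x v V 𝓕 := by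
  induction hC generalizing out with
  | simplex => exact exists_scribes_simplex hd hK hKc h0 out
  | stack V 𝓕 F n hC hF hn ih =>
    -- The normal of the facet to be stacked is requested outside `K`, in addition to the prescribed
    -- ones.
    obtain ⟨x, v, hS⟩ := ih fun G => G = F ∨ out G
    exact hS.stack hd hK.isClosed hKc (hC.isPseudomanifold hd) hF hn

/-! ### Tangency and polarity -/

namespace Realizes

variable {d : ℕ} {x : ℕ → E d} {v : Finset ℕ → E d} {V : Finset ℕ} {𝓕 : Finset (Finset ℕ)}

theorem isPolytope (hR : Realizes x (fun F => oneSub (v F)) V 𝓕) :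
    IsPolytope (convexHull ℝ (x '' V)) := by
  classical
  refine ⟨⟨V.image x, by rw [Finset.coe_image]⟩, 0, ?_⟩
  rw [mem_interior]
  refine ⟨⋂ F ∈ 𝓕, {y | inner ℝ (v F) y < 1}, ?_, ?_, ?_⟩
  · intro y hy
    rw [hR.mem_iff]
    intro F hF
    have : inner ℝ (v F) y < 1 := by
      have := Set.mem_iInter₂.1 hy F hF
      exact this
    rw [oneSub_apply]
    linarith
  · exact isOpen_biInter_finset fun F _ => isOpen_lt (by fun_prop) continuous_const
  · simp

theorem injOn_normal (hM : IsPseudomanifold d V 𝓕)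
    (hR : Realizes x (fun F => oneSub (v F)) V 𝓕) {F G : Finset ℕ} (hF : F ∈ 𝓕) (hG : G ∈ 𝓕)
    (hFG : v F = v G) : F = G := by
  refine hM.eq_of_subset hF hG fun i hi => ?_
  have h0 := hR.zero F hF i hi
  simp only [hFG] at h0
  exact (hR.zero_iff hG (hM.subset F hF hi)).1 h0

/-- If all facet normals are unit vectors, then the facets are tangent to the unit sphere. -/
theorem isScribed (hd : 1 ≤ d) (hM : IsPseudomanifold d V 𝓕)
    (hR : Realizes x (fun F => oneSub (v F)) V 𝓕) (hv : ∀ F ∈ 𝓕, ‖v F‖ = 1) :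
    IsScribed (d - 1) (convexHull ℝ (x '' V)) := by
  intro G hG
  obtain ⟨F, hF, rfl⟩ := hR.exists_eq_facet hd hM
    (G := G) ⟨hG.exposed, hG.nonempty, by rw [hG.dim_eq]; omega⟩
  set G := {y ∈ convexHull ℝ (x '' V) | oneSub (v F) y = 0} with hGdef
  have hself : oneSub (v F) (v F) = 0 := by
    rw [oneSub_apply, real_inner_self_eq_norm_sq, hv F hF]
    norm_num
  have hother : ∀ F' ∈ 𝓕, F' ≠ F → inner ℝ (v F') (v F) < 1 := fun F' hF' hne =>
    (inner_lt_one_iff_real_of_norm_eq_one (hv F' hF') (hv F hF)).2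
      fun he => hne (hR.injOn_normal hM hF' hF he)
  have hmem : v F ∈ G := by
    refine ⟨(hR.mem_iff _).2 fun F' hF' => ?_, hself⟩
    by_cases hne : F' = F
    · rw [hne, hself]
    · rw [oneSub_apply]
      linarith [hother F' hF' hne]
  have hspan : ∀ y ∈ affineSpan ℝ G, oneSub (v F) y = 0 := by
    intro y hy
    have hle : affineSpan ℝ G ≤ (AffineSubspace.comap (oneSub (v F))
        (affineSpan ℝ {(0 : ℝ)})) := by
      rw [affineSpan_le]
      intro y hy
      rw [SetLike.mem_coe, AffineSubspace.mem_comap, AffineSubspace.mem_affineSpan_singleton]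
      exact hy.2
    have := hle hy
    rwa [AffineSubspace.mem_comap, AffineSubspace.mem_affineSpan_singleton] at this
  -- The point of tangency is `v F` itself. Distinct unit normals have inner product below `1`, so
  -- all other inequalities are strict there and cut out a neighborhood within the affine span.
  refine ⟨v F, mem_intrinsicInterior.2 ⟨⟨v F, subset_affineSpan ℝ G hmem⟩, ?_, rfl⟩, ?_⟩
  · rw [mem_interior]
    refine ⟨⋂ F' ∈ 𝓕.erase F, {y | inner ℝ (v F') (y : E d) < 1}, ?_, ?_, ?_⟩
    · intro y hy
      refine ⟨(hR.mem_iff _).2 fun F' hF' => ?_, hspan y y.2⟩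
      by_cases hne : F' = F
      · rw [hne, hspan y y.2]
      · have : inner ℝ (v F') (y : E d) < 1 := by
          have := Set.mem_iInter₂.1 hy F' (Finset.mem_erase.2 ⟨hne, hF'⟩)
          exact this
        rw [oneSub_apply]
        linarith
    · exact isOpen_biInter_finset fun F _ => isOpen_lt (by fun_prop) continuous_const
    · refine Set.mem_iInter₂.2 fun F' hF' => ?_
      exact hother F' (Finset.mem_of_mem_erase hF') (Finset.ne_of_mem_erase hF')
  · refine subset_antisymm ?_ ?_
    · rintro y ⟨hy, hy1⟩
      have h1 := hspan y hy
      rw [oneSub_apply, sub_eq_zero] at h1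
      exact ((inner_eq_one_iff_of_norm_eq_one (hv F hF) (mem_sphere_zero_iff_norm.1 hy1)).1
        h1.symm).symm
    · rintro _ rfl
      exact ⟨subset_affineSpan ℝ G hmem, mem_sphere_zero_iff_norm.2 (hv F hF)⟩

/-- The polar polytope with respect to the point `o` is given by the inequalities that correspond
to the vertices. -/
theorem mem_polar_iff (h𝓕 : 𝓕.Nonempty) (hR : Realizes x (fun F => oneSub (v F)) V 𝓕) (o y : E d) :
    y ∈ convexHull ℝ (Set.range fun F : 𝓕 => o + v F) ↔ ∀ i : V, inner ℝ (x i) (y - o) ≤ 1 := by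
  constructor
  · intro hy i
    obtain ⟨w, hw, hw1, rfl⟩ := (mem_convexHull_range_iff _ _).1 hy
    have h1 : ∑ F, w F • (o + v F) - o = ∑ F, w F • v F := by
      simp_rw [smul_add, Finset.sum_add_distrib, ← Finset.sum_smul, hw1, one_smul,
        add_sub_cancel_left]
    rw [h1, inner_sum, ← hw1]
    refine Finset.sum_le_sum fun F _ => ?_
    rw [inner_smul_right]
    refine mul_le_of_le_one_right (hw F) ?_
    have := hR.nonneg F.2 i.2
    rw [oneSub_apply, real_inner_comm] at this
    linarith
  · intro hy
    by_contra hyQ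
    have hQ : IsClosed (convexHull ℝ (Set.range fun F : 𝓕 => o + v F)) :=
      ((Set.finite_range _).isCompact_convexHull ℝ).isClosed
    obtain ⟨f, u, hfu, huy⟩ := geometric_hahn_banach_closed_point (convex_convexHull ℝ _) hQ hyQ
    obtain ⟨w, rfl⟩ := (InnerProductSpace.toDual ℝ (E d)).surjective f
    simp only [InnerProductSpace.toDual_apply_apply] at hfu huy
    have hwv : ∀ F ∈ 𝓕, inner ℝ (v F) w < u - inner ℝ w o := by
      intro F hF
      have := hfu _ (subset_convexHull ℝ _ ⟨⟨F, hF⟩, rfl⟩)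
      rw [inner_add_right, real_inner_comm (v F)] at this
      linarith
    have hwy : u - inner ℝ w o < inner ℝ w (y - o) := by
      rw [inner_sub_right]
      linarith
    -- If the separating level were not positive, the whole ray of `w` would satisfy the facet
    -- inequalities, contradicting boundedness. So `w` can be rescaled to a point of the primal
    -- polytope that violates the bound on `y`.
    have hup : 0 < u - inner ℝ w o := by
      by_contra! hle
      have hcone : ∀ r : ℝ, 0 ≤ r → r • w ∈ convexHull ℝ (x '' V) := by
        intro r hr
        rw [hR.mem_iff]
        intro F hF
        rw [oneSub_apply, inner_smul_right]
        nlinarith [hwv F hF]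
      have hbdd : Bornology.IsBounded (convexHull ℝ (x '' V)) :=
        ((V.finite_toSet.image x).isCompact_convexHull ℝ).isBounded
      obtain ⟨C, hC⟩ := hbdd.exists_norm_le
      have hw0 : 0 < ‖w‖ := by
        rw [norm_pos_iff]
        rintro rfl
        simp only [inner_zero_left, sub_zero] at hwy hle
        obtain ⟨F, hF⟩ := h𝓕
        have := hfu _ (subset_convexHull ℝ _ ⟨⟨F, hF⟩, rfl⟩)
        rw [inner_zero_left] at this
        linarith
      have hC0 : 0 ≤ C := (norm_nonneg _).trans (hC _ (hcone 0 le_rfl))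
      have := hC _ (hcone ((C + 1) / ‖w‖) (by positivity))
      rw [norm_smul, Real.norm_of_nonneg (by positivity), div_mul_cancel₀ _ hw0.ne'] at this
      linarith
    have hmem : (u - inner ℝ w o)⁻¹ • w ∈ convexHull ℝ (x '' V) := by
      rw [hR.mem_iff]
      intro F hF
      rw [oneSub_apply, inner_smul_right, sub_nonneg, inv_mul_le_one₀ hup]
      exact (hwv F hF).le
    have hle : inner ℝ ((u - inner ℝ w o)⁻¹ • w) (y - o) ≤ 1 := by
      have hsub : convexHull ℝ (x '' V) ⊆ {z | 0 ≤ oneSub (y - o) z} := by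
        refine convexHull_min ?_ ((convex_Ici (0 : ℝ)).affine_preimage (oneSub (y - o)))
        rintro _ ⟨i, hi, rfl⟩
        have := hy ⟨i, hi⟩
        rw [Set.mem_ofPred_eq, oneSub_apply, real_inner_comm]
        linarith
      have h1 : 0 ≤ oneSub (y - o) ((u - inner ℝ w o)⁻¹ • w) := hsub hmem
      rw [oneSub_apply, real_inner_comm] at h1
      linarith
    rw [inner_smul_left, RCLike.conj_to_real, inv_mul_le_one₀ hup] at hle
    linarith

theorem isPolytope_polar (hM : IsPseudomanifold d V 𝓕)
    (hR : Realizes x (fun F => oneSub (v F)) V 𝓕) (o : E d) :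
    IsPolytope (convexHull ℝ (Set.range fun F : 𝓕 => o + v F)) := by
  classical
  refine ⟨⟨Finset.univ.image fun F : 𝓕 => o + v F, by simp⟩, o, ?_⟩
  rw [mem_interior]
  refine ⟨⋂ i ∈ V, {y | inner ℝ (x i) (y - o) < 1}, ?_, ?_, ?_⟩
  · intro y hy
    rw [hR.mem_polar_iff hM.nonempty]
    intro i
    have : inner ℝ (x i) (y - o) < 1 := by
      have := Set.mem_iInter₂.1 hy i i.2
      exact this
    exact this.le
  · exact isOpen_biInter_finset fun i _ => isOpen_lt (by fun_prop) continuous_const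
  · simp

/-- The inequality of `x i` is tight at `o + v F` exactly when `i ∈ F`. The polar has the transposed
incidence, and swapping extents with intents reverses the order. -/
theorem nonempty_polar_faceLattice_equiv (hd : 1 ≤ d) (hM : IsPseudomanifold d V 𝓕)
    (hR : Realizes x (fun F => oneSub (v F)) V 𝓕) (o : E d) :
    Nonempty (FaceLattice (convexHull ℝ (Set.range fun F : 𝓕 => o + v F)) ≃o
      (Concept V 𝓕 (fun i F => i.1 ∈ F.1))ᵒᵈ) := by
  choose k hk using fun i : V => exists_affineMap_eq_sub (innerSL ℝ (x i)) (1 + inner ℝ (x i) o)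
  have hk' : ∀ i y, k i y = 1 - inner ℝ (x i) (y - o) := by
    intro i y
    rw [hk, innerSL_apply_apply, inner_sub_right]
    ring
  have hinc : ∀ (F : 𝓕) (i : V), k i (o + v F) = 0 ↔ i.1 ∈ F.1 := by
    intro F i
    rw [← hR.zero_iff F.2 i.2, hk', add_sub_cancel_left, oneSub_apply, real_inner_comm]
  have hr : (fun (F : 𝓕) (i : V) => k i (o + v F) = 0) =
      Function.swap (fun (i : V) (F : 𝓕) => i.1 ∈ F.1) := by
    funext F i
    exact propext (hinc F i)
  have := nonempty_faceLattice_equiv_concept (fun F : 𝓕 => o + v F) k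
    (fun y => by
      rw [hR.mem_polar_iff hM.nonempty]
      simp [hk'])
    (fun F => by
      obtain ⟨i, hi, hiF⟩ := hM.exists_vertex_notMem hd F.2
      exact ⟨⟨i, hi⟩, fun h0 => hiF ((hinc F ⟨i, hi⟩).1 h0)⟩)
  rw [hr] at this
  obtain ⟨e⟩ := this
  exact ⟨e.trans Concept.swapEquiv.symm⟩

end Realizes

/-- A face of dimension `0` is a point, and being spanned by the generators it contains, it is one
of them. -/
theorem isScribed_zero {d : ℕ} {α : Type*} [Finite α] (p : α → E d) (hp : ∀ a, ‖p a‖ = 1) :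
    IsScribed 0 (convexHull ℝ (Set.range p)) := by
  have := Fintype.ofFinite α
  intro F hF
  obtain ⟨y, hy⟩ := hF.nonempty
  have hsub : F.Subsingleton := by
    rw [← vectorSpan_eq_bot_iff_subsingleton ℝ, ← Submodule.finrank_eq_zero]
    exact hF.dim_eq
  obtain rfl : F = {y} := hsub.eq_singleton_of_mem hy
  obtain ⟨w, -, hw1, -, hw⟩ := mem_convexHull_of_isExposed p hF.exposed hy
  obtain ⟨a, ha⟩ : ∃ a, w a ≠ 0 := by
    by_contra! hcon
    simp [hcon] at hw1
  have hya : p a = y := hw a ha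
  refine ⟨y, by simp, ?_⟩
  rw [AffineSubspace.coe_affineSpan_singleton, Set.inter_eq_left, Set.singleton_subset_iff,
    mem_sphere_zero_iff_norm, ← hya, hp]

/-! ### The three conclusions -/

/-- Every truncated polytope has a realization with vertices on the boundary of a given strictly
convex body. -/
theorem IsTruncated.exists_realization {d : ℕ} (hd : 1 ≤ d) {P : Set (E d)} (hP : IsTruncated P)
    {K : Set (E d)} (hK : IsCompact K) (hKc : StrictConvex ℝ K) {o : E d} (ho : o ∈ interior K) :
    ∃ (α : Type) (_ : Finite α) (p : α → E d), IsRealization (convexHull ℝ (Set.range p)) P ∧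
      ∀ a, p a ∈ frontier K := by
  obtain ⟨-, S, hS, ⟨e⟩⟩ := hP
  obtain ⟨V, 𝓕, hC, x₀, h₀, hR₀, rfl⟩ := hS.exists_realizes hd
  have hM := hC.isPseudomanifold hd
  -- `K` is translated so that `o` becomes the origin, as the construction requires; the polar is
  -- translated back by adding `o`.
  let T : E d ≃ₜ E d := Homeomorph.addLeft o
  have hT : ∀ y, T y = o + y := fun y => rfl
  obtain ⟨x, v, hS⟩ := hC.exists_scribes hd (K := T ⁻¹' K)
    (T.isClosedEmbedding.isCompact_preimage hK) (hKc.preimage_add_right o)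
    (by
      rw [← T.preimage_interior, Set.mem_preimage, hT, add_zero]
      exact ho) fun _ => False
  obtain ⟨e₁⟩ := hR₀.nonempty_faceLattice_equiv hM
  obtain ⟨e₂⟩ := hS.realizes.nonempty_polar_faceLattice_equiv hd hM o
  refine ⟨𝓕, inferInstance, fun F => o + v F, ⟨hS.realizes.isPolytope_polar hM o,
    ⟨(e₂.trans e₁.dual.symm).trans e.symm⟩⟩, fun F => ?_⟩
  have := hS.frontier F F.2 not_false
  rwa [← T.preimage_frontier, Set.mem_preimage, hT] at this

theorem IsStacked.isCircumscribable {d : ℕ} (hd : 1 ≤ d) {P : Set (E d)} (hP : IsStacked P) :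
    IsCircumscribable P := by
  obtain ⟨V, 𝓕, hC, x₀, h₀, hR₀, rfl⟩ := hP.exists_realizes hd
  have hM := hC.isPseudomanifold hd
  obtain ⟨x, v, hS⟩ := hC.exists_scribes hd (isCompact_closedBall (0 : E d) 1)
    (strictConvex_closedBall ℝ _ _)
    (by
      rw [interior_closedBall _ one_ne_zero]
      exact Metric.mem_ball_self one_pos) fun _ => False
  obtain ⟨e₁⟩ := hR₀.nonempty_faceLattice_equiv hM
  obtain ⟨e₂⟩ := hS.realizes.nonempty_faceLattice_equiv hM
  refine ⟨_, ⟨hS.realizes.isPolytope, ⟨e₂.trans e₁.symm⟩⟩, hS.realizes.isScribed hd hM ?_⟩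
  intro F hF
  have := hS.frontier F hF not_false
  rwa [frontier_closedBall _ one_ne_zero, mem_sphere_zero_iff_norm] at this

theorem IsTruncated.isInscribable {d : ℕ} (hd : 1 ≤ d) {P : Set (E d)} (hP : IsTruncated P) :
    IsInscribable P := by
  obtain ⟨α, _, p, hreal, hp⟩ := hP.exists_realization hd (isCompact_closedBall (0 : E d) 1)
    (strictConvex_closedBall ℝ _ _) (o := 0)
    (by
      rw [interior_closedBall _ one_ne_zero]
      exact Metric.mem_ball_self one_pos)
  refine ⟨_, hreal, isScribed_zero p fun a => ?_⟩
  have := hp a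
  rwa [frontier_closedBall _ one_ne_zero, mem_sphere_zero_iff_norm] at this

theorem IsTruncated.isInscribableIn {d : ℕ} (hd : 1 ≤ d) {P : Set (E d)} (hP : IsTruncated P)
    {K : Set (E d)} (hK : IsSmoothStrictlyConvexBody K) : IsInscribableIn P K := by
  obtain ⟨o, ho⟩ := hK.interior_nonempty
  obtain ⟨α, _, p, hreal, hp⟩ := hP.exists_realization hd hK.compact hK.strictConvex ho
  refine ⟨_, hreal, fun y hy => ?_⟩
  obtain ⟨a, rfl⟩ := extremePoints_convexHull_subset hy
  exact hp a

end Scribability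

theorem mainTheorem10 (d : ℕ) (hd : 1 ≤ d) :
    (∀ P : Set (Scribability.E d), Scribability.IsStacked P →
      Scribability.IsCircumscribable P) ∧
    (∀ P : Set (Scribability.E d), Scribability.IsTruncated P →
      Scribability.IsInscribable P) ∧
    (∀ P : Set (Scribability.E d), Scribability.IsTruncated P →
      ∀ K : Set (Scribability.E d), Scribability.IsSmoothStrictlyConvexBody K →
        Scribability.IsInscribableIn P K) := by
  exact ⟨fun P hP => hP.isCircumscribable hd, fun P hP => hP.isInscribable hd,
    fun P hP K hK => hP.isInscribableIn hd hK⟩
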